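/- **Setting.** Let $n=2^r$ with $r\ge 1$. An event consists of the hits in the three innermost detector layers, $\mathbf m_{l,j}$ for $l\in\{0,1,2\}$ and $j\in\{0,\dots,n-1\}$ (each either missing or given by a $w$-bit string, $w\ge 0$ arbitrary), together with a seeding criterion, i.e. an arbitrary Boolean function on triplets of hits. A triplet $(j_0,j_1,j_2)$ is a *good seed* if the hits $\mathbf m_{0,j_0},\mathbf m_{1,j_1},\mathbf m_{2,j_2}$ are all present and satisfy the criterion; $k_{\rm seed}$ is the number of good seeds. **Computational model.** A quantum algorithm is a classical controller that repeatedly either runs a quantum circuit on $|0\cdots0\rangle$ and measures all qubits, or classically tests whether one given triplet is a good seed, or halts with an output. It accesses the event only through tests, QRAM accesses $\mathbf Q_l|j\rangle|x\rangle=|j\rangle|x\oplus \mathbf m_{l,j}\rangle$, and the transformation $\mathbf U_{seed}$, which multiplies the basis state of a triplet of hits by $-1$ if the triplet passes the seeding stage and by $+1$ otherwise. Circuits consist of one-qubit gates, QRAM accesses and $\mathbf U_{seed}$, each possibly controlled by at most two further qubits. The time is the number of gates, where a QRAM access counts $c_1\log_2 n$ and $\mathbf U_{seed}$ counts $c_2$,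 plus $c_3$ per classical test, for arbitrary constants $c_1,c_2,c_3\in\mathbb N$. **Algorithms.** A *quantum counting algorithm* is a family of quantum algorithms, depending on $n$ and $w$ but not on the event, that on every event outputs $k_{\rm seed}$ with probability at least $3/4$ and has expected running time $\tilde O\big(\sqrt{n^3\max(k_{\rm seed},1)}\big)$. Let $\mathbf O_{seed}$ multiply $|j_0,j_1,j_2\rangle$ by $-1$ if $(j_0,j_1,j_2)$ is a good seed and by $+1$ otherwise (a circuit for it loads the three hits from the QRAM, applies $\mathbf U_{seed}$, and unloads the hits), let $\mathbf H$ be the Walsh–Hadamard transform on $3\log_2 n$ qubits, and let $\mathbf G=\mathbf H(2|0\rangle\langle 0|-I)\mathbf H\,\mathbf O_{seed}$. *Quantum seed generation* with a quantum counting algorithm $\mathbf{QCount}$ is the following algorithm: 1. $\tilde k\leftarrow \mathbf{QCount}$; 2. set $m=\lfloor \pi/(4\theta)\rfloor$, $\theta=\arcsin\sqrt{\tilde k/n^3}$; 3. while fewer than $\tilde k$ distinct good seeds have been found: prepare and measure $\mathbf G^m\,\frac1{\sqrt{n^3}}\sum_{j_0,j_1,j_2}|j_0,j_1,j_2\rangle$;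 test the outcome $(j_0,j_1,j_2)$ and, if it is a good seed, add it to the output. **Theorem.** Quantum counting algorithms exist. For every quantum counting algorithm $\mathbf{QCount}$ there are constants $C,p$ such that, for all $n=2^r$ with $r\ge1$, all $w$ and all events, with $$B=C\,\sqrt{n^3\max(k_{\rm seed},1)}\;(\log n)^p=\tilde O\big(\sqrt{n^3\max(k_{\rm seed},1)}\big),$$ quantum seed generation satisfies: * the probability that it halts with exactly the set of all good seeds as its output equals the probability that $\mathbf{QCount}$ outputs $k_{\rm seed}$ (hence is at least $3/4$); * with probability at least $1/2$ it halts within time $B$, with exactly the set of all good seeds as its output; * its expected running time, conditioned on the event that it halts with the set of all good seeds as its output, is at most $B$. -/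

import Mathlib

open scoped ENNReal

namespace SeedGen

noncomputable section

/-! ### The data: hits in the three innermost layers

There are `n = 2 ^ r` labels per layer; a label is identified with its `r` binary digits. -/

/-- A hit label `j ∈ {0, …, 2 ^ r - 1}`, written in binary. -/
abbrev Label (r : ℕ) := Fin r → Bool

/-- The coordinates of a hit, stored in `w` bits. -/
abbrev Hit (w : ℕ) := Fin w → Bool

/-- A triplet of labels `(j₀, j₁, j₂)`, one for each of the three innermost layers. -/
abbrev Triplet (r : ℕ) := Fin 3 → Label r

/-- The input of seed generation. `hit l j` is the `j`-th hit in layer `l` (`none` if there is no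
such hit), and `criterion` is the seeding criterion on triplets of hits. -/
structure Event (r w : ℕ) where
  hit : Fin 3 → Label r → Option (Hit w)
  criterion : (Fin 3 → Hit w) → Bool

/-- The seeding stage accepts a triplet if all its hits are present and the criterion holds. -/
def Event.accepts {r w : ℕ} (E : Event r w) (h : Fin 3 → Option (Hit w)) : Bool :=
  decide (∃ v : Fin 3 → Hit w, (∀ l, h l = some (v l)) ∧ E.criterion v = true)

/-- The triplet of labels `j` is a good seed. -/
def Event.isGood {r w : ℕ} (E : Event r w) (j : Triplet r) : Bool :=
  E.accepts fun l => E.hit l (j l)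

/-- The set of all good seeds. -/
def Event.goodSeeds {r w : ℕ} (E : Event r w) : Finset (Triplet r) :=
  Finset.univ.filter fun j => E.isGood j = true

/-- The number `k_seed` of good seeds. -/
def Event.kSeed {r w : ℕ} (E : Event r w) : ℕ := E.goodSeeds.card

/-! ### Quantum circuits with QRAM -/

/-- The contents of a hit register: a presence bit (index `none`) and `w` coordinate bits.
A missing hit is flagged by the presence bit `false`. -/
def encode {w : ℕ} : Option (Hit w) → Option (Fin w) → Bool
  | none, _ => false
  | some _, none => true
  | some v, some b => v b

/-- The hit stored in a hit register with the given contents. -/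
def decode {w : ℕ} (y : Option (Fin w) → Bool) : Option (Hit w) :=
  if y none = true then some fun b => y (some b) else none

/-- Operations on a set `Q` of qubits: one-qubit unitaries; the QRAM access
`|j⟩|x⟩ ↦ |j⟩|x ⊕ m_{l,j}⟩` for layer `l`; and the transformation `U_seed` on three hit registers,
which multiplies a basis state by `-1` iff the stored hits pass the seeding stage. -/
inductive Op (r w : ℕ) (Q : Type) : Type
  | oneQubit (U : Matrix.unitaryGroup Bool ℂ) (t : Q)
  | qram (l : Fin 3) (addr : Fin r ↪ Q) (data : Option (Fin w) ↪ Q)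
      (disj : ∀ i b, addr i ≠ data b)
  | seed (data : Fin 3 × Option (Fin w) ↪ Q)

/-- The qubits on which an operation acts. -/
def Op.support {r w : ℕ} {Q : Type} : Op r w Q → Set Q
  | .oneQubit _ t => {t}
  | .qram _ addr data _ => Set.range addr ∪ Set.range data
  | .seed data => Set.range data

/-- A gate is an operation, controlled by at most two further qubits. -/
structure Gate (r w : ℕ) (Q : Type) : Type where
  op : Op r w Q
  controls : Finset Q
  card_le : controls.card ≤ 2
  disj : ∀ q ∈ controls, q ∉ op.support

/-- A circuit is a list of gates; the head of the list is applied first. -/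
abbrev Circuit (r w : ℕ) (Q : Type) := List (Gate r w Q)

/-- State vectors, in coordinates with respect to the computational basis. -/
abbrev State (Q : Type) := (Q → Bool) → ℂ

/-- The state `|0 … 0⟩`. -/
def zeroState (Q : Type) [Fintype Q] [DecidableEq Q] : State Q := Pi.single (fun _ => false) 1

open Classical in
/-- The QRAM access on basis states: the contents `y` are added bitwise to the register `data`. -/
def xorInto {w : ℕ} {Q : Type} (data : Option (Fin w) ↪ Q) (y : Option (Fin w) → Bool)
    (x : Q → Bool) : Q → Bool :=
  fun q => xor (x q) (decide (∃ b, data b = q ∧ y b = true))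

/-- The action of an operation on state vectors. (The basis permutation of a QRAM access is an
involution.) -/
def Op.apply {r w : ℕ} {Q : Type} [DecidableEq Q] (E : Event r w) :
    Op r w Q → State Q → State Q
  | .oneQubit U t, ψ => fun x => ∑ b : Bool, U.1 (x t) b * ψ (Function.update x t b)
  | .qram l addr data _, ψ => fun x =>
      ψ (xorInto data (encode (E.hit l fun i => x (addr i))) x)
  | .seed data, ψ => fun x =>
      (if E.accepts (fun l => decode fun b => x (data (l, b))) = true then -1 else 1) * ψ x

open Classical in
/-- The action of a gate: the operation is applied where all control qubits are `1`. -/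
def Gate.apply {r w : ℕ} {Q : Type} [DecidableEq Q] (E : Event r w) (g : Gate r w Q)
    (ψ : State Q) : State Q :=
  fun x => if ∀ q ∈ g.controls, x q = true then g.op.apply E ψ x else ψ x

/-- The state produced by a circuit from `|0 … 0⟩`. -/
def finalState {r w : ℕ} {Q : Type} [Fintype Q] [DecidableEq Q] (E : Event r w)
    (c : Circuit r w Q) : State Q :=
  c.foldl (fun ψ g => g.apply E ψ) (zeroState Q)

/-- Born rule: the probability of reading `x` when all qubits are measured. -/
def measureProb {r w : ℕ} {Q : Type} [Fintype Q] [DecidableEq Q] (E : Event r w)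
    (c : Circuit r w Q) (x : Q → Bool) : ℝ≥0∞ :=
  ENNReal.ofReal (‖finalState E c x‖ ^ 2)

/-! ### Time -/

/-- The constants of the cost model: a QRAM access takes `qram * log₂ n` time, `U_seed` takes
`seed` time, and classically testing one given triplet of hits takes `test` time. All other gates
take one unit of time. -/
structure CostModel where
  qram : ℕ
  seed : ℕ
  test : ℕ

/-- The time taken by a gate. -/
def Gate.cost {r w : ℕ} {Q : Type} (κ : CostModel) (g : Gate r w Q) : ℕ :=
  match g.op with
  | .oneQubit _ _ => 1
  | .qram _ _ _ _ => κ.qram * r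
  | .seed _ => κ.seed

/-- The time taken by a circuit. -/
def circuitCost {r w : ℕ} {Q : Type} (κ : CostModel) (c : Circuit r w Q) : ℕ :=
  (c.map (Gate.cost κ)).sum

/-! ### Quantum algorithms with classical control -/

/-- What an algorithm with output type `α` and classical states `S` does next: it halts with an
output, or it runs a circuit on `|0 … 0⟩`, measures all qubits and continues according to the
outcome, or it classically tests whether a given triplet is a good seed. -/
inductive Action (r w : ℕ) (S α : Type) : Type 1
  | halt (a : α)
  | measure (Q : Type) [Fintype Q] [DecidableEq Q] (c : Circuit r w Q) (next : (Q → Bool) → S)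
  | test (j : Triplet r) (next : Bool → S)

/-- A quantum algorithm with output type `α`. It does not depend on the event, which it can access
only through QRAM accesses, `U_seed` gates and tests. -/
structure QAlg (r w : ℕ) (α : Type) : Type 1 where
  S : Type
  start : S
  act : S → Action r w S α

/-- The expectation of `f output time` over the runs that start in the classical state `s` with
`t` units of time already spent and that halt within the given number of actions. -/
def QAlg.expectFrom {r w : ℕ} {α : Type} (A : QAlg r w α) (κ : CostModel) (E : Event r w)
    (f : α → ℕ → ℝ≥0∞) : ℕ → A.S → ℕ → ℝ≥0∞
  | 0, _, _ => 0
  | N + 1, s, t =>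
    match A.act s with
    | .halt a => f a t
    | @Action.measure _ _ _ _ Q _ _ c next =>
        ∑ x : Q → Bool, measureProb E c x *
          A.expectFrom κ E f N (next x) (t + circuitCost κ c)
    | .test j next => A.expectFrom κ E f N (next (E.isGood j)) (t + κ.test)

/-- The expectation of `f output time` over all halting runs. -/
def QAlg.expectOnHalt {r w : ℕ} {α : Type} (A : QAlg r w α) (κ : CostModel) (E : Event r w)
    (f : α → ℕ → ℝ≥0∞) : ℝ≥0∞ :=
  ⨆ N : ℕ, A.expectFrom κ E f N A.start 0

open Classical in
/-- The probability that the algorithm halts with output `a` after time `t` such that `P a t`. -/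
def QAlg.prob {r w : ℕ} {α : Type} (A : QAlg r w α) (κ : CostModel) (E : Event r w)
    (P : α → ℕ → Prop) : ℝ≥0∞ :=
  A.expectOnHalt κ E fun a t => if P a t then 1 else 0

open Classical in
/-- The integral of the running time over the event that the algorithm halts with an output `a`
such that `P a`. Divided by the probability of this event, it is the expected running time
conditioned on the event. -/
def QAlg.timeOn {r w : ℕ} {α : Type} (A : QAlg r w α) (κ : CostModel) (E : Event r w)
    (P : α → Prop) : ℝ≥0∞ :=
  A.expectOnHalt κ E fun a t => if P a then (t : ℝ≥0∞) else 0

/-- The expected time spent within the given number of actions, starting from `s`. -/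
def QAlg.expectedTimeFrom {r w : ℕ} {α : Type} (A : QAlg r w α) (κ : CostModel)
    (E : Event r w) : ℕ → A.S → ℝ≥0∞
  | 0, _ => 0
  | N + 1, s =>
    match A.act s with
    | .halt _ => 0
    | @Action.measure _ _ _ _ Q _ _ c next =>
        (circuitCost κ c : ℝ≥0∞) +
          ∑ x : Q → Bool, measureProb E c x * A.expectedTimeFrom κ E N (next x)
    | .test j next => (κ.test : ℝ≥0∞) + A.expectedTimeFrom κ E N (next (E.isGood j))

/-- The expected running time over all runs. -/
def QAlg.expectedTime {r w : ℕ} {α : Type} (A : QAlg r w α) (κ : CostModel)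
    (E : Event r w) : ℝ≥0∞ :=
  ⨆ N : ℕ, A.expectedTimeFrom κ E N A.start

/-! ### Grover search for seeds -/

/-- The Hadamard gate. -/
def hadamard : Matrix.unitaryGroup Bool ℂ :=
  ⟨Matrix.of fun a b => if a = true ∧ b = true then -((√2 : ℝ) : ℂ)⁻¹ else ((√2 : ℝ) : ℂ)⁻¹, by
    rw [Matrix.mem_unitaryGroup_iff]
    have h : ((√2 : ℝ) : ℂ)⁻¹ * ((√2 : ℝ) : ℂ)⁻¹ = 1 / 2 := by
      rw [← mul_inv, ← Complex.ofReal_mul, Real.mul_self_sqrt (by norm_num)]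
      norm_num
    ext a b
    cases a <;> cases b <;>
      simp [Matrix.mul_apply, Matrix.star_apply, Complex.conj_ofReal, h]
    norm_num⟩

/-- The NOT gate. -/
def pauliX : Matrix.unitaryGroup Bool ℂ :=
  ⟨Matrix.of fun a b => if a = b then 0 else 1, by
    rw [Matrix.mem_unitaryGroup_iff]
    ext a b
    cases a <;> cases b <;> simp [Matrix.mul_apply, Matrix.star_apply]⟩

/-- The gate `|0⟩ ↦ -|0⟩`, `|1⟩ ↦ |1⟩`. -/
def negZ : Matrix.unitaryGroup Bool ℂ :=
  ⟨Matrix.of fun a b => if a = b then (if a = true then 1 else -1) else 0, by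
    rw [Matrix.mem_unitaryGroup_iff]
    ext a b
    cases a <;> cases b <;> simp [Matrix.mul_apply, Matrix.star_apply]⟩

/-- An uncontrolled gate. -/
def Gate.plain {r w : ℕ} {Q : Type} (op : Op r w Q) : Gate r w Q :=
  ⟨op, ∅, by simp, by simp⟩

/-- The qubits used in Grover search: the registers holding `j₀, j₁, j₂`, three hit registers, and
ancillas for the reflection. -/
abbrev GQubit (r w : ℕ) := (Fin 3 × Fin r) ⊕ ((Fin 3 × Option (Fin w)) ⊕ Fin (3 * r + 1))

/-- The `i`-th qubit of the register holding `j_l`. -/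
def addrQ (r w : ℕ) (l : Fin 3) (i : Fin r) : GQubit r w := .inl (l, i)

/-- The `i`-th ancilla. -/
def ancQ (r w : ℕ) (i : Fin (3 * r + 1)) : GQubit r w := .inr (.inr i)

/-- The `i`-th among all `3 * r` qubits holding `j₀, j₁, j₂`. -/
def flatQ (r w : ℕ) (i : Fin (3 * r)) : GQubit r w := .inl (finProdFinEquiv.symm i)

/-- Apply a one-qubit gate to each of the `3 * r` qubits holding `j₀, j₁, j₂`. -/
def layer (r w : ℕ) (U : Matrix.unitaryGroup Bool ℂ) : Circuit r w (GQubit r w) :=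
  (List.finRange (3 * r)).map fun i => Gate.plain (.oneQubit U (flatQ r w i))

/-- Load the hit `m_{l, j_l}` from the QRAM. -/
def loadGate (r w : ℕ) (l : Fin 3) : Gate r w (GQubit r w) :=
  Gate.plain <| .qram l
    ⟨fun i => .inl (l, i), fun i i' h => by simpa using h⟩
    ⟨fun b => .inr (.inl (l, b)), fun b b' h => by simpa using h⟩
    (fun _ _ h => by simp at h)

/-- `U_seed` on the three hit registers. -/
def seedGate (r w : ℕ) : Gate r w (GQubit r w) :=
  Gate.plain <| .seed ⟨fun d => .inr (.inl d), fun d d' h => by simpa using h⟩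

/-- A circuit for `O_seed`: load the three hits, apply `U_seed`, and unload the hits. -/
def oracleCircuit (r w : ℕ) : Circuit r w (GQubit r w) :=
  [loadGate r w 0, loadGate r w 1, loadGate r w 2, seedGate r w,
    loadGate r w 2, loadGate r w 1, loadGate r w 0]

/-- The Toffoli gate from the `i`-th qubit of the search register and the `i`-th ancilla to the
`(i + 1)`-st ancilla. -/
def ladderGate (r w : ℕ) (i : Fin (3 * r)) : Gate r w (GQubit r w) where
  op := .oneQubit pauliX (ancQ r w i.succ)
  controls := {flatQ r w i, ancQ r w i.castSucc}
  card_le := Finset.card_le_two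
  disj := by
    intro q hq
    simp only [Finset.mem_insert, Finset.mem_singleton] at hq
    rcases hq with rfl | rfl
    · simp [Op.support, flatQ, ancQ]
    · simp [Op.support, ancQ, Fin.ext_iff]

/-- A circuit for `2|0⟩⟨0| - I` on the search register: compute into the last ancilla whether all
qubits are `0`, change the sign if not, and uncompute. -/
def reflectionCircuit (r w : ℕ) : Circuit r w (GQubit r w) :=
  layer r w pauliX ++ [Gate.plain (.oneQubit pauliX (ancQ r w 0))] ++
    (List.finRange (3 * r)).map (ladderGate r w) ++
    [Gate.plain (.oneQubit negZ (ancQ r w (Fin.last (3 * r))))] ++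
    ((List.finRange (3 * r)).map (ladderGate r w)).reverse ++
    [Gate.plain (.oneQubit pauliX (ancQ r w 0))] ++ layer r w pauliX

/-- A circuit for `G = H (2|0⟩⟨0| - I) H O_seed`. -/
def groverStep (r w : ℕ) : Circuit r w (GQubit r w) :=
  oracleCircuit r w ++ layer r w hadamard ++ reflectionCircuit r w ++ layer r w hadamard

/-- A circuit that prepares `G ^ m` applied to the uniform superposition of all triplets. -/
def groverCircuit (r w m : ℕ) : Circuit r w (GQubit r w) :=
  layer r w hadamard ++ (List.replicate m (groverStep r w)).flatten

/-- The number `m = ⌊π / (4 θ)⌋` of Grover iterations, `θ = arcsin √(k / n ^ 3)`, `n = 2 ^ r`. -/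
def groverIterations (r k : ℕ) : ℕ :=
  ⌊Real.pi / (4 * Real.arcsin √((k : ℝ) / ((2 : ℝ) ^ r) ^ 3))⌋₊

/-! ### Quantum seed generation -/

/-- The classical states of quantum seed generation: the counting subroutine is running; or the
estimate `k` and the set `found` of good seeds have been obtained; or, in addition, `j` has been
measured and is about to be tested. -/
inductive SeedState (S : Type) (r : ℕ) : Type
  | counting (s : S)
  | searching (k : ℕ) (found : Finset (Triplet r))
  | testing (k : ℕ) (found : Finset (Triplet r)) (j : Triplet r)

/-- The head of the loop `while fewer than k good seeds have been found`: halt, or prepare and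
measure the Grover state. -/
def searchAction {r w : ℕ} {S : Type} (k : ℕ) (found : Finset (Triplet r)) :
    Action r w (SeedState S r) (Finset (Triplet r)) :=
  if found.card < k then
    .measure (GQubit r w) (groverCircuit r w (groverIterations r k))
      fun x => .testing k found fun l i => x (addrQ r w l i)
  else .halt found

/-- Quantum seed generation with the counting subroutine `count`: estimate the number of good seeds
by `count`, then repeat Grover search until that many distinct good seeds have been found. -/
def quantumSeeding {r w : ℕ} (count : QAlg r w ℕ) : QAlg r w (Finset (Triplet r)) where
  S := SeedState count.S r
  start := .counting count.start
  act
    | .counting s =>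
      match count.act s with
      | .halt k => searchAction k ∅
      | @Action.measure _ _ _ _ Q _ _ c next => .measure Q c fun x => .counting (next x)
      | .test j next => .test j fun b => .counting (next b)
    | .searching k found => searchAction k found
    | .testing k found j =>
      .test j fun b => .searching k (if b = true then insert j found else found)

/-- The time bound `C √(n³ max(k, 1)) (log n) ^ p`, where `n = 2 ^ r`. -/
def timeBound (C : ℝ) (p r k : ℕ) : ℝ :=
  C * √(((2 : ℝ) ^ r) ^ 3 * (max k 1 : ℕ)) * Real.log ((2 : ℝ) ^ r) ^ p

/-- `count` is a quantum counting algorithm: on every event it outputs `k_seed` with probability at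
least `3/4`, and its expected running time is `Õ(√(n³ max(k_seed, 1)))`. -/
def IsQuantumCounting (κ : CostModel) (count : (r w : ℕ) → QAlg r w ℕ) : Prop :=
  ∃ (C : ℝ) (p : ℕ), ∀ (r w : ℕ), 1 ≤ r → ∀ E : Event r w,
    3 / 4 ≤ (count r w).prob κ E (fun k _ => k = E.kSeed) ∧
    (count r w).expectedTime κ E ≤ ENNReal.ofReal (timeBound C p r E.kSeed)

end

end SeedGen

/-! Write `N = n³`, `k = k_seed` and `sin² θ = k / N`. The hit registers and ancillas start clean
and every Grover step cleans them again, so the circuits act on amplitudes over triplets (`embed`).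
There the oracle is a sign and the rest of the step is inversion about the average
(`run_groverStep_embed`). The amplitudes take one value on good triplets and one on bad ones, and
each step rotates this pair by `2θ` (`run_groverCircuit`). Hence after `m` steps each good seed is
measured with the same probability `sin²((2m+1)θ) / k`.

Call `m` suitable if `sin²((2m+1)θ) ≥ 1/2`; `⌊π/(4θ)⌋` is suitable. With a suitable `m` a search
finds a new seed with probability at least `(k - found) / (2k)`. So the loop is a coupon collector:
about `2k · H_k` searches of `O(√(N/k))` iterations, in total `Õ(√(Nk))`. All potential arguments go
through `sum_outcomeProb_step_le`.

If the count is correct, the loop ends almost surely with all good seeds (`value_searching_kSeed`).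
If it is too small, the loop stops with too few seeds; if too large, it never stops
(`value_searching_of_ne`). This gives the equality of probabilities, and it is why the expected time
has to be restricted to success. On that event the time is at most the expected time of the counting
subroutine plus the loop bound times the success probability `p`. As `p ≥ 3/4`, dividing by `p`
costs a constant factor, and Markov's inequality gives the tail bound.

For the existence of a counting algorithm no phase estimation is used: `seedCount` collects the
seeds with `θ` unknown. The iteration numbers with `2m+1 = 3^j` contain a suitable one, because the
interval `[π/4, 3π/4]` has endpoints of ratio 3 (`exists_suitable`). Phase `g` assumes about `2^g`
seeds, and a later phase starts only once more than `2^g` seeds have actually been found. Thus no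
run, even an unlucky one, spends more than `Õ(√(N max(k,1)))`. -/

namespace SeedGen

noncomputable section

/-! ### Expectations over all halting runs -/

section Value

variable {r w : ℕ} {α : Type} (A : QAlg r w α) (κ : CostModel) (E : Event r w)

/-- The expectation of `f output time` over all halting runs that start in the classical state `s`
with `t` units of time already spent. -/
def QAlg.value (f : α → ℕ → ℝ≥0∞) (s : A.S) (t : ℕ) : ℝ≥0∞ :=
  ⨆ N : ℕ, A.expectFrom κ E f N s t

variable {A} in
theorem QAlg.expectFrom_halt {s : A.S} {a : α} (h : A.act s = .halt a) (f : α → ℕ → ℝ≥0∞)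
    (N t : ℕ) : A.expectFrom κ E f (N + 1) s t = f a t := by
  simp only [QAlg.expectFrom, h]

variable {A} in
theorem QAlg.expectFrom_measure {s : A.S} {Q : Type} [Fintype Q] [DecidableEq Q]
    {c : Circuit r w Q} {next : (Q → Bool) → A.S} (h : A.act s = .measure Q c next)
    (f : α → ℕ → ℝ≥0∞) (N t : ℕ) :
    A.expectFrom κ E f (N + 1) s t =
      ∑ x, measureProb E c x * A.expectFrom κ E f N (next x) (t + circuitCost κ c) := by
  simp only [QAlg.expectFrom, h]

variable {A} in
theorem QAlg.expectFrom_test {s : A.S} {j : Triplet r} {next : Bool → A.S}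
    (h : A.act s = .test j next) (f : α → ℕ → ℝ≥0∞) (N t : ℕ) :
    A.expectFrom κ E f (N + 1) s t =
      A.expectFrom κ E f N (next (E.isGood j)) (t + κ.test) := by
  simp only [QAlg.expectFrom, h]

variable {A} in
theorem QAlg.expectedTimeFrom_halt {s : A.S} {a : α} (h : A.act s = .halt a) (N : ℕ) :
    A.expectedTimeFrom κ E (N + 1) s = 0 := by
  simp only [QAlg.expectedTimeFrom, h]

variable {A} in
theorem QAlg.expectedTimeFrom_measure {s : A.S} {Q : Type} [Fintype Q] [DecidableEq Q]
    {c : Circuit r w Q} {next : (Q → Bool) → A.S} (h : A.act s = .measure Q c next) (N : ℕ) :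
    A.expectedTimeFrom κ E (N + 1) s =
      circuitCost κ c + ∑ x, measureProb E c x * A.expectedTimeFrom κ E N (next x) := by
  simp only [QAlg.expectedTimeFrom, h]

variable {A} in
theorem QAlg.expectedTimeFrom_test {s : A.S} {j : Triplet r} {next : Bool → A.S}
    (h : A.act s = .test j next) (N : ℕ) :
    A.expectedTimeFrom κ E (N + 1) s =
      κ.test + A.expectedTimeFrom κ E N (next (E.isGood j)) := by
  simp only [QAlg.expectedTimeFrom, h]

/-- Case distinction on the next action. -/
theorem QAlg.act_cases {A : QAlg r w α} {P : Prop} (s : A.S)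
    (halt : ∀ a, A.act s = .halt a → P)
    (measure : ∀ (Q : Type) (_ : Fintype Q) (_ : DecidableEq Q) (c : Circuit r w Q)
      (next : (Q → Bool) → A.S), A.act s = .measure Q c next → P)
    (test : ∀ (j : Triplet r) (next : Bool → A.S), A.act s = .test j next → P) : P := by
  cases h : A.act s with
  | halt a => exact halt a h
  | @measure Q i1 i2 c next => exact measure Q i1 i2 c next h
  | test j next => exact test j next h

/-- Runs that exhaust the budget contribute `0`, so a larger budget only adds terms. This
monotonicity makes the suprema behave like limits. -/
theorem QAlg.expectFrom_le_succ (f : α → ℕ → ℝ≥0∞) (N : ℕ) (s : A.S) (t : ℕ) :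
    A.expectFrom κ E f N s t ≤ A.expectFrom κ E f (N + 1) s t := by
  induction N generalizing s t with
  | zero => simp [QAlg.expectFrom]
  | succ N ih =>
    refine QAlg.act_cases s (fun a h => ?_) (fun Q _ _ c next h => ?_) (fun j next h => ?_)
    · simp only [QAlg.expectFrom_halt κ E h, le_refl]
    · simp only [QAlg.expectFrom_measure κ E h]
      gcongr
      exact ih _ _
    · simp only [QAlg.expectFrom_test κ E h]
      exact ih _ _

theorem QAlg.monotone_expectFrom (f : α → ℕ → ℝ≥0∞) (s : A.S) (t : ℕ) :
    Monotone fun N => A.expectFrom κ E f N s t :=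
  monotone_nat_of_le_succ fun N => A.expectFrom_le_succ κ E f N s t

theorem QAlg.expectFrom_le_value (f : α → ℕ → ℝ≥0∞) (N : ℕ) (s : A.S) (t : ℕ) :
    A.expectFrom κ E f N s t ≤ A.value κ E f s t :=
  le_iSup (fun N => A.expectFrom κ E f N s t) N

/-- Dropping the budget `0` from the supremum allows one action to be unfolded in every remaining
term. -/
theorem QAlg.value_eq_iSup_succ (f : α → ℕ → ℝ≥0∞) (s : A.S) (t : ℕ) :
    A.value κ E f s t = ⨆ N : ℕ, A.expectFrom κ E f (N + 1) s t :=
  ((A.monotone_expectFrom κ E f s t).iSup_nat_add 1).symm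

variable {A} in
theorem QAlg.value_halt {s : A.S} {a : α} (h : A.act s = .halt a) (f : α → ℕ → ℝ≥0∞) (t : ℕ) :
    A.value κ E f s t = f a t := by
  rw [QAlg.value_eq_iSup_succ]
  simp only [QAlg.expectFrom_halt κ E h, iSup_const]

variable {A} in
-- Monotone convergence: the supremum over budgets commutes with the finite sum over measurement
-- outcomes.
theorem QAlg.value_measure {s : A.S} {Q : Type} [Fintype Q] [DecidableEq Q]
    {c : Circuit r w Q} {next : (Q → Bool) → A.S} (h : A.act s = .measure Q c next)
    (f : α → ℕ → ℝ≥0∞) (t : ℕ) :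
    A.value κ E f s t =
      ∑ x, measureProb E c x * A.value κ E f (next x) (t + circuitCost κ c) := by
  rw [QAlg.value_eq_iSup_succ]
  simp only [QAlg.expectFrom_measure κ E h, QAlg.value, ENNReal.mul_iSup]
  rw [ENNReal.finsetSum_iSup_of_monotone]
  intro x N M hNM
  dsimp only
  gcongr
  exact A.monotone_expectFrom κ E f _ _ hNM

variable {A} in
theorem QAlg.value_test {s : A.S} {j : Triplet r} {next : Bool → A.S}
    (h : A.act s = .test j next) (f : α → ℕ → ℝ≥0∞) (t : ℕ) :
    A.value κ E f s t = A.value κ E f (next (E.isGood j)) (t + κ.test) := by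
  rw [QAlg.value_eq_iSup_succ]
  simp only [QAlg.expectFrom_test κ E h, QAlg.value]

theorem QAlg.prob_eq_value (P : α → ℕ → Prop) [∀ a t, Decidable (P a t)] :
    A.prob κ E P = A.value κ E (fun a t => if P a t then 1 else 0) A.start 0 := by
  unfold QAlg.prob QAlg.expectOnHalt QAlg.value
  congr!

theorem QAlg.timeOn_eq_value (P : α → Prop) [∀ a, Decidable (P a)] :
    A.timeOn κ E P = A.value κ E (fun a t => if P a then (t : ℝ≥0∞) else 0) A.start 0 := by
  unfold QAlg.timeOn QAlg.expectOnHalt QAlg.value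
  congr!

theorem QAlg.expectFrom_mono {f g : α → ℕ → ℝ≥0∞} (hfg : ∀ a t, f a t ≤ g a t) (N : ℕ)
    (s : A.S) (t : ℕ) : A.expectFrom κ E f N s t ≤ A.expectFrom κ E g N s t := by
  induction N generalizing s t with
  | zero => simp [QAlg.expectFrom]
  | succ N ih =>
    refine QAlg.act_cases s (fun a h => ?_) (fun Q _ _ c next h => ?_) (fun j next h => ?_)
    · simpa only [QAlg.expectFrom_halt κ E h] using hfg a t
    · simp only [QAlg.expectFrom_measure κ E h]
      gcongr
      exact ih _ _
    · simp only [QAlg.expectFrom_test κ E h]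
      exact ih _ _

theorem QAlg.value_mono {f g : α → ℕ → ℝ≥0∞} (hfg : ∀ a t, f a t ≤ g a t)
    (s : A.S) (t : ℕ) : A.value κ E f s t ≤ A.value κ E g s t :=
  iSup_mono fun N => A.expectFrom_mono κ E hfg N s t

theorem QAlg.expectFrom_add (f g : α → ℕ → ℝ≥0∞) (N : ℕ) (s : A.S) (t : ℕ) :
    A.expectFrom κ E (fun a t => f a t + g a t) N s t =
      A.expectFrom κ E f N s t + A.expectFrom κ E g N s t := by
  induction N generalizing s t with
  | zero => simp [QAlg.expectFrom]
  | succ N ih =>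
    refine QAlg.act_cases s (fun a h => ?_) (fun Q _ _ c next h => ?_) (fun j next h => ?_)
    · simp only [QAlg.expectFrom_halt κ E h]
    · simp only [QAlg.expectFrom_measure κ E h, ih, mul_add, Finset.sum_add_distrib]
    · simp only [QAlg.expectFrom_test κ E h, ih]

/-- Only this direction is needed, to split the time of the subroutine from that of the loop and to
prove Markov's inequality. -/
theorem QAlg.value_add_le (f g : α → ℕ → ℝ≥0∞) (s : A.S) (t : ℕ) :
    A.value κ E (fun a t => f a t + g a t) s t ≤ A.value κ E f s t + A.value κ E g s t := by
  refine iSup_le fun N => ?_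
  rw [QAlg.expectFrom_add]
  exact add_le_add (A.expectFrom_le_value κ E f N s t) (A.expectFrom_le_value κ E g N s t)

theorem QAlg.expectFrom_const_mul (C : ℝ≥0∞) (f : α → ℕ → ℝ≥0∞) (N : ℕ) (s : A.S) (t : ℕ) :
    A.expectFrom κ E (fun a t => C * f a t) N s t = C * A.expectFrom κ E f N s t := by
  induction N generalizing s t with
  | zero => simp [QAlg.expectFrom]
  | succ N ih =>
    refine QAlg.act_cases s (fun a h => ?_) (fun Q _ _ c next h => ?_) (fun j next h => ?_)
    · simp only [QAlg.expectFrom_halt κ E h]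
    · simp only [QAlg.expectFrom_measure κ E h, ih, Finset.mul_sum, mul_left_comm C]
    · simp only [QAlg.expectFrom_test κ E h, ih]

theorem QAlg.value_const_mul (C : ℝ≥0∞) (f : α → ℕ → ℝ≥0∞) (s : A.S) (t : ℕ) :
    A.value κ E (fun a t => C * f a t) s t = C * A.value κ E f s t := by
  simp only [QAlg.value, QAlg.expectFrom_const_mul, ENNReal.mul_iSup]

theorem QAlg.value_time_irrel (f : α → ℝ≥0∞) (s : A.S) (t t' : ℕ) :
    A.value κ E (fun a _ => f a) s t = A.value κ E (fun a _ => f a) s t' := by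
  refine iSup_congr fun N => ?_
  induction N generalizing s t t' with
  | zero => simp [QAlg.expectFrom]
  | succ N ih =>
    refine QAlg.act_cases s (fun a h => ?_) (fun Q _ _ c next h => ?_) (fun j next h => ?_)
    · simp only [QAlg.expectFrom_halt κ E h]
    · simp only [QAlg.expectFrom_measure κ E h]
      exact Finset.sum_congr rfl fun x _ => by rw [ih]
    · simp only [QAlg.expectFrom_test κ E h]
      exact ih _ _ _

end Value

/-! ### Circuits preserve the norm -/

section Norm

variable {r w : ℕ} {Q : Type} (E : Event r w)

/-- Flip the qubit `t` of a basis state. -/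
def flipBit [DecidableEq Q] (t : Q) (x : Q → Bool) : Q → Bool := Function.update x t (!x t)

theorem flipBit_self [DecidableEq Q] (t : Q) (x : Q → Bool) : flipBit t x t = !x t := by simp [flipBit]

theorem flipBit_of_ne [DecidableEq Q] {t : Q} (h : q ≠ t) (x : Q → Bool) : flipBit t x q = x q := by
  simp [flipBit, h]

theorem flipBit_involutive [DecidableEq Q] (t : Q) : Function.Involutive (flipBit t) := by
  intro x
  simp [flipBit]

theorem xorInto_of_forall_ne (data : Option (Fin w) ↪ Q) (y : Option (Fin w) → Bool)
    (x : Q → Bool) {q : Q} (h : ∀ b, data b ≠ q) : xorInto data y x q = x q := by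
  simp [xorInto, h]

theorem xorInto_apply_data (data : Option (Fin w) ↪ Q) (y : Option (Fin w) → Bool)
    (x : Q → Bool) (b : Option (Fin w)) : xorInto data y x (data b) = xor (x (data b)) (y b) := by
  simp [xorInto]

theorem xorInto_xorInto (data : Option (Fin w) ↪ Q) (y : Option (Fin w) → Bool)
    (x : Q → Bool) : xorInto data y (xorInto data y x) = x := by
  funext q
  simp [xorInto]

/-- The permutation of the basis states that a QRAM access performs. -/
def qramMap (l : Fin 3) (addr : Fin r ↪ Q) (data : Option (Fin w) ↪ Q) (x : Q → Bool) :
    Q → Bool :=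
  xorInto data (encode (E.hit l fun i => x (addr i))) x

theorem qramMap_addr {l : Fin 3} {addr : Fin r ↪ Q} {data : Option (Fin w) ↪ Q}
    (x : Q → Bool) {q : Q} (h : ∀ b, data b ≠ q) : qramMap E l addr data x q = x q :=
  xorInto_of_forall_ne _ _ _ h

/-- The address qubits lie outside the data register, so a second access adds the same hit again. -/
theorem qramMap_involutive {l : Fin 3} {addr : Fin r ↪ Q} {data : Option (Fin w) ↪ Q}
    (disj : ∀ i b, addr i ≠ data b) : Function.Involutive (qramMap E l addr data) := by
  intro x
  have h : (fun i => qramMap E l addr data x (addr i)) = fun i => x (addr i) :=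
    funext fun i => qramMap_addr E x fun b => (disj i b).symm
  rw [qramMap, h, qramMap, xorInto_xorInto]

variable [DecidableEq Q] [Fintype Q]

/-- Pairs each basis state with its flip at `t`; a one-qubit gate on `t` acts on each pair as a `2 ×
2` unitary. -/
theorem two_mul_sum_eq_sum_flipBit (t : Q) (F : (Q → Bool) → ℝ) :
    2 * ∑ x, F x = ∑ x, (F x + F (flipBit t x)) := by
  rw [Finset.sum_add_distrib, two_mul]
  congr 1
  exact (Equiv.sum_comp (flipBit_involutive t).toPerm F).symm

theorem normSq_mulVec_unitary (U : Matrix.unitaryGroup Bool ℂ) (v : Bool → ℂ) :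
    ∑ a, ‖∑ b, U.1 a b * v b‖ ^ 2 = ∑ b, ‖v b‖ ^ 2 := by
  have h : star (U.1.mulVec v) ⬝ᵥ (U.1.mulVec v) = star v ⬝ᵥ v := by
    rw [Matrix.star_mulVec, Matrix.dotProduct_mulVec, Matrix.vecMul_vecMul,
      ← Matrix.star_eq_conjTranspose, Matrix.UnitaryGroup.star_mul_self, Matrix.vecMul_one]
  have key : ∀ u : Bool → ℂ, star u ⬝ᵥ u = ((∑ b, ‖u b‖ ^ 2 : ℝ) : ℂ) := by
    intro u
    simp only [dotProduct, Pi.star_apply, RCLike.star_def, Complex.conj_mul']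
    push_cast
    rfl
  rw [key, key] at h
  exact_mod_cast h

/-- Each kind of operation is norm-preserving for its own reason: unitary on pairs of basis states,
an involutive permutation of the basis, or a sign. The controls lie outside the support, so the
condition they impose is unchanged by the operation. -/
theorem sum_normSq_gate (g : Gate r w Q) (ψ : State Q) :
    ∑ x, ‖g.apply E ψ x‖ ^ 2 = ∑ x, ‖ψ x‖ ^ 2 := by
  classical
  obtain ⟨op, controls, card_le, disj⟩ := g
  cases op with
  | oneQubit U t =>
    have ht : t ∉ controls := fun h => disj t h (by simp [Op.support])
    have h2 : (2 : ℝ) ≠ 0 := two_ne_zero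
    rw [← mul_right_inj' h2, two_mul_sum_eq_sum_flipBit t, two_mul_sum_eq_sum_flipBit t]
    refine Finset.sum_congr rfl fun x _ => ?_
    have hc : (∀ q ∈ controls, flipBit t x q = true) ↔ ∀ q ∈ controls, x q = true :=
      forall₂_congr fun q hq => by
        rw [flipBit_of_ne (ne_of_mem_of_not_mem hq ht)]
    by_cases h : ∀ q ∈ controls, x q = true
    · simp only [Gate.apply, Op.apply]
      rw [if_pos h, if_pos (hc.2 h)]
      have := normSq_mulVec_unitary U fun b => ψ (Function.update x t b)
      simp only [flipBit, Function.update_self, Function.update_idem]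
      have hx : Function.update x t (x t) = x := Function.update_eq_self t x
      cases hxt : x t <;> rw [hxt] at hx <;> simp [hx] at this ⊢ <;> linarith
    · simp only [Gate.apply]
      rw [if_neg h, if_neg (mt hc.1 h)]
  | qram l addr data dj =>
    have hd : ∀ q ∈ controls, ∀ b, data b ≠ q := fun q hq b h =>
      disj q hq (by simp [Op.support, ← h])
    have hinv : Function.Involutive fun x : Q → Bool =>
        if ∀ q ∈ controls, x q = true then qramMap E l addr data x else x := by
      intro x
      by_cases h : ∀ q ∈ controls, x q = true
      · have h' : ∀ q ∈ controls, qramMap E l addr data x q = true := fun q hq => by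
          rw [qramMap_addr E x (hd q hq)]; exact h q hq
        dsimp only
        rw [if_pos h, if_pos h', qramMap_involutive E dj x]
      · dsimp only
        rw [if_neg h, if_neg h]
    rw [← Equiv.sum_comp hinv.toPerm fun x => ‖ψ x‖ ^ 2]
    refine Finset.sum_congr rfl fun x _ => ?_
    simp only [Gate.apply, Op.apply, Function.Involutive.coe_toPerm]
    split_ifs <;> rfl
  | seed data =>
    refine Finset.sum_congr rfl fun x _ => ?_
    simp only [Gate.apply, Op.apply]
    split_ifs <;> simp

theorem sum_measureProb (c : Circuit r w Q) : ∑ x, measureProb E c x = 1 := by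
  have key : ∀ (c : Circuit r w Q) (ψ : State Q),
      ∑ x, ‖c.foldl (fun ψ g => g.apply E ψ) ψ x‖ ^ 2 = ∑ x, ‖ψ x‖ ^ 2 := by
    intro c
    induction c with
    | nil => intro ψ; rfl
    | cons g c ih => intro ψ; rw [List.foldl_cons, ih, sum_normSq_gate]
  simp only [measureProb, finalState]
  rw [← ENNReal.ofReal_sum_of_nonneg fun _ _ => by positivity, key]
  simp [zeroState, Pi.single_apply, apply_ite norm, ite_pow]

end Norm

/-- Only an inequality: runs that do not halt within the budget are counted on the right but not on
the left. -/
theorem QAlg.expectFrom_time_le {r w : ℕ} {α : Type} (A : QAlg r w α) (κ : CostModel)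
    (E : Event r w) (N : ℕ) (s : A.S) (t : ℕ) :
    A.expectFrom κ E (fun _ t => (t : ℝ≥0∞)) N s t ≤ t + A.expectedTimeFrom κ E N s := by
  induction N generalizing s t with
  | zero => simp [QAlg.expectFrom]
  | succ N ih =>
    refine QAlg.act_cases s (fun a h => ?_) (fun Q _ _ c next h => ?_) (fun j next h => ?_)
    · simp only [QAlg.expectFrom_halt κ E h]
      exact le_self_add
    · rw [QAlg.expectFrom_measure κ E h, QAlg.expectedTimeFrom_measure κ E h]
      calc _ ≤ ∑ x, measureProb E c x *
              (((t + circuitCost κ c : ℕ) : ℝ≥0∞) + A.expectedTimeFrom κ E N (next x)) := by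
            gcongr
            exact ih _ _
        _ = _ := by
            simp only [mul_add, Finset.sum_add_distrib, ← Finset.sum_mul, sum_measureProb, one_mul]
            push_cast
            ring
    · rw [QAlg.expectFrom_test κ E h, QAlg.expectedTimeFrom_test κ E h]
      refine (ih _ _).trans (le_of_eq ?_)
      push_cast
      ring

/-! ### The action of the circuits of Grover search -/

section Circuits

variable {r w : ℕ} {Q : Type} [DecidableEq Q] (E : Event r w)

/-- The action of a circuit on state vectors. -/
def runCircuit (c : Circuit r w Q) (ψ : State Q) : State Q :=
  c.foldl (fun ψ g => g.apply E ψ) ψ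

theorem runCircuit_nil (ψ : State Q) : runCircuit E [] ψ = ψ := rfl

theorem runCircuit_cons (g : Gate r w Q) (c : Circuit r w Q) (ψ : State Q) :
    runCircuit E (g :: c) ψ = runCircuit E c (g.apply E ψ) := rfl

theorem runCircuit_append (c d : Circuit r w Q) (ψ : State Q) :
    runCircuit E (c ++ d) ψ = runCircuit E d (runCircuit E c ψ) :=
  List.foldl_append

theorem Gate.plain_apply (op : Op r w Q) (ψ : State Q) :
    (Gate.plain op).apply E ψ = op.apply E ψ := by
  funext x
  simp [Gate.apply, Gate.plain]

/-- A permutation gate acts on state vectors by precomposition, so the gate applied last moves the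
basis label first; hence `foldr`. -/
theorem runCircuit_map_pull {ι : Type} (g : ι → Gate r w Q) (σ : ι → (Q → Bool) → Q → Bool)
    (h : ∀ i ψ x, (g i).apply E ψ x = ψ (σ i x)) (L : List ι) (ψ : State Q) (x : Q → Bool) :
    runCircuit E (L.map g) ψ x = ψ (L.foldr σ x) := by
  induction L generalizing ψ x with
  | nil => rfl
  | cons i L ih => rw [List.map_cons, runCircuit_cons, ih, h, List.foldr_cons]

theorem pauliX_apply (t : Q) (ψ : State Q) (x : Q → Bool) :
    (Op.oneQubit (r := r) (w := w) pauliX t).apply E ψ x = ψ (flipBit t x) := by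
  cases h : x t <;> simp [Op.apply, pauliX, flipBit, h]

theorem negZ_apply (t : Q) (ψ : State Q) (x : Q → Bool) :
    (Op.oneQubit (r := r) (w := w) negZ t).apply E ψ x = (if x t = true then 1 else -1) * ψ x := by
  have hx : Function.update x t (x t) = x := Function.update_eq_self t x
  cases h : x t <;> rw [h] at hx <;> simp [Op.apply, negZ, h, hx]

/-- Undoing a sequence of involutions in reverse order: this is the uncomputation of the Toffoli
ladder. -/
theorem foldr_foldl_of_involutive {ι X : Type} (σ : ι → X → X)
    (h : ∀ i, Function.Involutive (σ i)) (L : List ι) (x : X) :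
    L.foldr σ (L.foldl (fun x i => σ i x) x) = x := by
  induction L generalizing x with
  | nil => rfl
  | cons i L ih => rw [List.foldl_cons, List.foldr_cons, ih, h i]

theorem foldr_flipBit {ι : Type} (f : ι → Q) (L : List ι) (hL : (L.map f).Nodup) (x : Q → Bool)
    (q : Q) : L.foldr (fun i => flipBit (f i)) x q = if q ∈ L.map f then !x q else x q := by
  induction L with
  | nil => rfl
  | cons i L ih =>
    rw [List.map_cons, List.nodup_cons] at hL
    rw [List.foldr_cons]
    by_cases hq : q = f i
    · subst hq
      rw [flipBit_self, ih hL.2, if_neg hL.1, if_pos (by simp)]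
    · rw [flipBit_of_ne hq, ih hL.2]
      simp only [List.map_cons, List.mem_cons, hq, false_or]

end Circuits

/-! #### Tensor products of one-qubit operations -/

section Tensor

variable {r w : ℕ} {Q : Type} [DecidableEq Q] [Fintype Q] (E : Event r w)

/-- The tensor product of the matrices `k q`. -/
def tensorApply (k : Q → Matrix Bool Bool ℂ) (ψ : State Q) : State Q :=
  fun x => ∑ y : Q → Bool, (∏ q, k q (x q) (y q)) * ψ y

theorem tensorApply_one (ψ : State Q) : tensorApply (fun _ => 1) ψ = ψ := by
  funext x
  have h : ∀ y : Q → Bool, (∏ q, (1 : Matrix Bool Bool ℂ) (x q) (y q)) = if x = y then 1 else 0 := by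
    intro y
    simp only [Matrix.one_apply]
    rw [Finset.prod_ite_zero]
    simp [funext_iff]
  simp [tensorApply, h]

/-- A gate on the qubit `t` multiplies only the factor of the tensor product at `t`. -/
theorem oneQubit_tensorApply (U : Matrix.unitaryGroup Bool ℂ) (t : Q)
    (k : Q → Matrix Bool Bool ℂ) (ψ : State Q) :
    (Op.oneQubit U t).apply E (tensorApply k ψ) =
      tensorApply (Function.update k t (U.1 * k t)) ψ := by
  funext x
  simp only [Op.apply, tensorApply, Finset.mul_sum]
  rw [Finset.sum_comm]
  refine Finset.sum_congr rfl fun y _ => ?_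
  have h1 : ∀ b, ∏ q, k q (Function.update x t b q) (y q) =
      k t b (y t) * ∏ q ∈ Finset.univ.erase t, k q (x q) (y q) := by
    intro b
    rw [← Finset.mul_prod_erase _ _ (Finset.mem_univ t), Function.update_self]
    congr 1
    refine Finset.prod_congr rfl fun q hq => ?_
    rw [Function.update_of_ne (Finset.ne_of_mem_erase hq)]
  have h2 : ∏ q, Function.update k t (U.1 * k t) q (x q) (y q) =
      (U.1 * k t) (x t) (y t) * ∏ q ∈ Finset.univ.erase t, k q (x q) (y q) := by
    rw [← Finset.mul_prod_erase _ _ (Finset.mem_univ t), Function.update_self]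
    congr 1
    refine Finset.prod_congr rfl fun q hq => ?_
    rw [Function.update_of_ne (Finset.ne_of_mem_erase hq)]
  rw [h2, Matrix.mul_apply, Finset.sum_mul, Finset.sum_mul]
  refine Finset.sum_congr rfl fun b _ => ?_
  rw [h1]
  ring

theorem runCircuit_map_oneQubit (U : Matrix.unitaryGroup Bool ℂ) (L : List Q) (hL : L.Nodup)
    (k : Q → Matrix Bool Bool ℂ) (ψ : State Q) :
    runCircuit E (L.map fun q => Gate.plain (.oneQubit U q)) (tensorApply k ψ) =
      tensorApply (fun q => if q ∈ L then U.1 * k q else k q) ψ := by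
  induction L generalizing k with
  | nil => simp [runCircuit_nil]
  | cons t L ih =>
    rw [List.nodup_cons] at hL
    rw [List.map_cons, runCircuit_cons, Gate.plain_apply, oneQubit_tensorApply, ih hL.2]
    congr 1
    funext q
    by_cases hq : q = t
    · subst hq
      simp [hL.1]
    · simp [hq]

/-- The state is viewed as the tensor product of identities applied to it, and the gates then fill
in the factors one by one. -/
theorem runCircuit_oneQubit_univ (U : Matrix.unitaryGroup Bool ℂ) (L : List Q) (hL : L.Nodup)
    (hmem : ∀ q, q ∈ L) (ψ : State Q) :
    runCircuit E (L.map fun q => Gate.plain (.oneQubit U q)) ψ = tensorApply (fun _ => U.1) ψ := by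
  have h := runCircuit_map_oneQubit E U L hL (fun _ => 1) ψ
  rw [tensorApply_one] at h
  simpa [hmem] using h

theorem tensorApply_tensorApply (k k' : Q → Matrix Bool Bool ℂ) (ψ : State Q) :
    tensorApply k (tensorApply k' ψ) = tensorApply (fun q => k q * k' q) ψ := by
  funext x
  simp only [tensorApply, Finset.mul_sum]
  rw [Finset.sum_comm]
  refine Finset.sum_congr rfl fun y _ => ?_
  simp only [Matrix.mul_apply]
  rw [Finset.prod_univ_sum, Fintype.piFinset_univ, Finset.sum_mul]
  refine Finset.sum_congr rfl fun z _ => ?_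
  rw [Finset.prod_mul_distrib]
  ring

theorem hadamard_false_apply (b : Bool) : hadamard.1 false b = ((√2 : ℝ) : ℂ)⁻¹ := by
  simp [hadamard]

theorem hadamard_apply_false (b : Bool) : hadamard.1 b false = ((√2 : ℝ) : ℂ)⁻¹ := by
  simp [hadamard]

theorem hadamard_mul_self : hadamard.1 * hadamard.1 = 1 := by
  have h : star hadamard.1 = hadamard.1 := by
    ext a b
    cases a <;> cases b <;> simp [hadamard, Matrix.star_apply, Complex.conj_ofReal]
  have := Matrix.UnitaryGroup.star_mul_self hadamard
  rwa [h] at this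

theorem tensorApply_hadamard_zeroState (x : Q → Bool) :
    tensorApply (fun _ => hadamard.1) (zeroState Q) x =
      ((√((2 : ℝ) ^ Fintype.card Q) : ℝ) : ℂ)⁻¹ := by
  have h2 : ∀ n : ℕ, √((2 : ℝ) ^ n) = √2 ^ n := fun n => by
    rw [Real.sqrt_eq_iff_mul_self_eq (by positivity) (by positivity), ← mul_pow,
      Real.mul_self_sqrt (by norm_num)]
  simp [tensorApply, zeroState, Pi.single_apply, hadamard_apply_false, h2]

/-- The operation `H (2|0⟩⟨0| - I) H` is the inversion about the average. -/
theorem hadamard_reflect_hadamard (φ : State Q) (x : Q → Bool) :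
    tensorApply (fun _ => hadamard.1)
        (fun y => (if y = (fun _ => false) then 1 else -1) *
          tensorApply (fun _ => hadamard.1) φ y) x =
      2 * (∑ y, φ y) / 2 ^ Fintype.card Q - φ x := by
  set n := Fintype.card Q
  have h0 : tensorApply (fun _ => hadamard.1) φ (fun _ => false) =
      ((√((2 : ℝ) ^ n) : ℝ) : ℂ)⁻¹ * ∑ y, φ y := by
    have h2 : √((2 : ℝ) ^ n) = √2 ^ n := by
      rw [Real.sqrt_eq_iff_mul_self_eq (by positivity) (by positivity), ← mul_pow,
        Real.mul_self_sqrt (by norm_num)]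
    simp [tensorApply, hadamard_false_apply, h2, Finset.mul_sum, n]
  -- The reflection of a vector `v` is `2 v(0) |0⟩ - v`; then the outer Hadamard transform acts
  -- linearly, sending `|0⟩` to the uniform vector and undoing the inner transform on `v`.
  have h1 : (fun y => (if y = (fun _ => false) then (1 : ℂ) else -1) *
      tensorApply (fun _ => hadamard.1) φ y) = fun y =>
      2 * tensorApply (fun _ => hadamard.1) φ (fun _ => false) * zeroState Q y -
        tensorApply (fun _ => hadamard.1) φ y := by
    funext y
    by_cases hy : y = fun _ => false
    · subst hy
      simp [zeroState]
      ring
    · simp [zeroState, hy]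
  have hlin : ∀ (a : ℂ) (u v : State Q), tensorApply (fun _ => hadamard.1)
      (fun y => a * u y - v y) x = a * tensorApply (fun _ => hadamard.1) u x -
        tensorApply (fun _ => hadamard.1) v x := by
    intro a u v
    simp only [tensorApply, Finset.mul_sum, ← Finset.sum_sub_distrib]
    exact Finset.sum_congr rfl fun y _ => by ring
  have hN : ((√((2 : ℝ) ^ n) : ℝ) : ℂ)⁻¹ * ((√((2 : ℝ) ^ n) : ℝ) : ℂ)⁻¹ = (2 ^ n)⁻¹ := by
    rw [← mul_inv, ← Complex.ofReal_mul, Real.mul_self_sqrt (by positivity)]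
    push_cast
    rfl
  rw [h1, hlin, tensorApply_tensorApply, hadamard_mul_self, tensorApply_one,
    tensorApply_hadamard_zeroState, h0]
  rw [show ∀ a b c : ℂ, 2 * (a * b) * a - c = 2 * b * (a * a) - c by intros; ring, hN,
    div_eq_mul_inv]

end Tensor

/-! #### The Grover circuit -/

section Grover

variable {r w : ℕ} (E : Event r w)

/-- The triplet of labels that is read off a basis state. -/
def outcome (x : GQubit r w → Bool) : Triplet r := fun l i => x (addrQ r w l i)

/-- The triplet of labels with the given binary digits. -/
def ofBits (a : Fin 3 × Fin r → Bool) : Triplet r := fun l i => a (l, i)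

/-- The state with the given amplitudes on the search register, all other qubits being `0`. -/
def embed (φ : State (Fin 3 × Fin r)) : State (GQubit r w) :=
  fun x => if ∀ q, x (.inr q) = false then φ fun i => x (.inl i) else 0

theorem embed_of_clean (φ : State (Fin 3 × Fin r)) {x : GQubit r w → Bool}
    (hx : ∀ q, x (.inr q) = false) : embed φ x = φ fun i => x (.inl i) := if_pos hx

theorem embed_of_not_clean (φ : State (Fin 3 × Fin r)) {x : GQubit r w → Bool}
    (hx : ¬ ∀ q, x (.inr q) = false) : embed φ x = 0 := if_neg hx

/-- A gate on the search register does not affect whether the other qubits are clean. -/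
theorem oneQubit_embed (U : Matrix.unitaryGroup Bool ℂ) (t : Fin 3 × Fin r)
    (φ : State (Fin 3 × Fin r)) :
    (Op.oneQubit U (.inl t)).apply E (embed (w := w) φ) =
      embed ((Op.oneQubit U t).apply E φ) := by
  funext x
  have h : ∀ b, (fun i => Function.update x (Sum.inl t) b (Sum.inl i)) =
      Function.update (fun i => x (.inl i)) t b := by
    intro b
    funext i
    by_cases hi : i = t
    · subst hi; simp
    · rw [Function.update_of_ne hi, Function.update_of_ne (by simpa using hi)]
  have hc : ∀ b, (∀ q, Function.update x (Sum.inl t) b (.inr q) = false) ↔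
      ∀ q, x (.inr q) = false := fun b => by simp only [Function.update_of_ne Sum.inr_ne_inl]
  by_cases hx : ∀ q, x (.inr q) = false
  · rw [embed_of_clean _ hx]
    refine Finset.sum_congr rfl fun b _ => ?_
    rw [embed_of_clean _ ((hc b).2 hx), h]
  · rw [embed_of_not_clean _ hx]
    refine Finset.sum_eq_zero fun b _ => ?_
    rw [embed_of_not_clean _ (mt (hc b).1 hx), mul_zero]

/-- The qubits of the search register in the order of `flatQ`. -/
def addrList (r : ℕ) : List (Fin 3 × Fin r) :=
  (List.finRange (3 * r)).map finProdFinEquiv.symm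

theorem nodup_addrList : (addrList r).Nodup :=
  (List.nodup_finRange _).map finProdFinEquiv.symm.injective

theorem mem_addrList (i : Fin 3 × Fin r) : i ∈ addrList r :=
  List.mem_map.2 ⟨finProdFinEquiv i, List.mem_finRange _, by simp⟩

theorem layer_eq (U : Matrix.unitaryGroup Bool ℂ) :
    layer r w U = (addrList r).map fun i => Gate.plain (.oneQubit U (.inl i)) := by
  rw [layer, addrList, List.map_map]
  rfl

theorem run_layer_embed (U : Matrix.unitaryGroup Bool ℂ) (φ : State (Fin 3 × Fin r)) :
    runCircuit E (layer r w U) (embed φ) = embed (tensorApply (fun _ => U.1) φ) := by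
  rw [← runCircuit_oneQubit_univ E U _ nodup_addrList mem_addrList φ, layer_eq]
  induction addrList r generalizing φ with
  | nil => rfl
  | cons t L ih =>
    simp only [List.map_cons, runCircuit_cons, Gate.plain_apply, oneQubit_embed, ih]

/-- The address register of layer `l`. -/
def addrEmb (r w : ℕ) (l : Fin 3) : Fin r ↪ GQubit r w :=
  ⟨fun i => .inl (l, i), fun i i' h => by simpa using h⟩

/-- The hit register of layer `l`. -/
def dataEmb (r w : ℕ) (l : Fin 3) : Option (Fin w) ↪ GQubit r w :=
  ⟨fun b => .inr (.inl (l, b)), fun b b' h => by simpa using h⟩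

/-- The permutation of the basis states that `loadGate` performs. -/
def loadMap (l : Fin 3) : (GQubit r w → Bool) → GQubit r w → Bool :=
  qramMap E l (addrEmb r w l) (dataEmb r w l)

theorem loadGate_apply (l : Fin 3) (ψ : State (GQubit r w)) (x : GQubit r w → Bool) :
    (loadGate r w l).apply E ψ x = ψ (loadMap E l x) := by
  rw [loadGate, Gate.plain_apply]
  rfl

theorem loadMap_involutive (l : Fin 3) : Function.Involutive (loadMap (r := r) (w := w) E l) :=
  qramMap_involutive E fun i b h => by simp [addrEmb, dataEmb] at h

theorem loadMap_inl (l : Fin 3) (x : GQubit r w → Bool) (i : Fin 3 × Fin r) :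
    loadMap E l x (.inl i) = x (.inl i) :=
  qramMap_addr E x fun b h => by simp [dataEmb] at h

theorem loadMap_data_of_ne {l l' : Fin 3} (h : l' ≠ l) (x : GQubit r w → Bool)
    (b : Option (Fin w)) : loadMap E l x (.inr (.inl (l', b))) = x (.inr (.inl (l', b))) :=
  qramMap_addr E x fun _ h' => h (congrArg Prod.fst (Sum.inl.inj (Sum.inr.inj h'))).symm

theorem loadMap_data (l : Fin 3) (x : GQubit r w → Bool) (b : Option (Fin w)) :
    loadMap E l x (.inr (.inl (l, b))) =
      xor (x (.inr (.inl (l, b)))) (encode (E.hit l (outcome x l)) b) :=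
  xorInto_apply_data (dataEmb r w l) _ x b

theorem decode_encode (h : Option (Hit w)) : decode (encode h) = h := by
  cases h <;> simp [decode, encode]

/-- The six loads cancel in pairs, leaving the sign of `U_seed` evaluated at the loaded basis state.
On clean registers XOR-loading stores exactly the encoded hits, so this sign tells whether the
triplet is a good seed. -/
theorem run_oracle_embed (φ : State (Fin 3 × Fin r)) :
    runCircuit E (oracleCircuit r w) (embed φ) =
      embed fun a => (if E.isGood (ofBits a) = true then -1 else 1) * φ a := by
  funext x
  have hseed : ∀ ψ : State (GQubit r w), ∀ x, (seedGate r w).apply E ψ x =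
      (if E.accepts (fun l => decode fun b => x (.inr (.inl (l, b)))) = true then -1 else 1) *
        ψ x := by
    intro ψ x
    rw [seedGate, Gate.plain_apply]
    rfl
  simp only [oracleCircuit, runCircuit_cons, runCircuit_nil, loadGate_apply, hseed,
    loadMap_involutive E _ _]
  by_cases hx : ∀ q, x (.inr q) = false
  · simp only [embed, hx, implies_true, if_true]
    congr 3
    rw [Event.isGood]
    congr 1
    funext l
    have ho : ∀ l' y, outcome (loadMap (r := r) (w := w) E l' y) = outcome y := by
      intro l' y
      funext l i
      exact loadMap_inl E l' y (l, i)
    have h : (fun b => loadMap E 2 (loadMap E 1 (loadMap E 0 x)) (.inr (.inl (l, b)))) =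
        encode (E.hit l (outcome x l)) := by
      funext b
      fin_cases l
      · simp [loadMap_data_of_ne, loadMap_data, hx]
      · simp [loadMap_data_of_ne, loadMap_data, hx, ho]
      · simp [loadMap_data_of_ne, loadMap_data, hx, ho]
    rw [h, decode_encode]
    rfl
  · simp only [embed_of_not_clean _ hx, mul_zero]

/-- The permutation of the basis states that `ladderGate` performs. -/
def ladderMap (i : Fin (3 * r)) (x : GQubit r w → Bool) : GQubit r w → Bool :=
  if x (flatQ r w i) = true ∧ x (ancQ r w i.castSucc) = true then flipBit (ancQ r w i.succ) x
  else x

theorem ladderGate_apply (i : Fin (3 * r)) (ψ : State (GQubit r w)) (x : GQubit r w → Bool) :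
    (ladderGate r w i).apply E ψ x = ψ (ladderMap i x) := by
  have h : (∀ q ∈ (ladderGate r w i).controls, x q = true) ↔
      x (flatQ r w i) = true ∧ x (ancQ r w i.castSucc) = true := by
    simp [ladderGate]
  simp only [Gate.apply, h, ladderMap]
  split_ifs
  · exact pauliX_apply E _ ψ x
  · rfl

theorem ancQ_injective : Function.Injective (ancQ r w) := fun i j h => by
  simpa [ancQ] using h

theorem ladderMap_inl (i : Fin (3 * r)) (x : GQubit r w → Bool) (a : Fin 3 × Fin r) :
    ladderMap i x (.inl a) = x (.inl a) := by
  unfold ladderMap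
  split_ifs
  · exact flipBit_of_ne (by simp [ancQ]) x
  · rfl

theorem ladderMap_anc_of_ne {i : Fin (3 * r)} {j : Fin (3 * r + 1)} (h : j ≠ i.succ)
    (x : GQubit r w → Bool) : ladderMap i x (ancQ r w j) = x (ancQ r w j) := by
  unfold ladderMap
  split_ifs
  · exact flipBit_of_ne (ancQ_injective.ne h) x
  · rfl

theorem ladderMap_anc_succ (i : Fin (3 * r)) (x : GQubit r w → Bool) :
    ladderMap i x (ancQ r w i.succ) =
      xor (x (ancQ r w i.succ)) (x (flatQ r w i) && x (ancQ r w i.castSucc)) := by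
  unfold ladderMap
  split_ifs with h
  · rw [flipBit_self, h.1, h.2]; simp
  · cases h1 : x (flatQ r w i) <;> cases h2 : x (ancQ r w i.castSucc) <;> simp_all

theorem ladderMap_involutive (i : Fin (3 * r)) :
    Function.Involutive (ladderMap (r := r) (w := w) i) := by
  intro x
  by_cases h : x (flatQ r w i) = true ∧ x (ancQ r w i.castSucc) = true
  · have h1 : ladderMap i x (flatQ r w i) = true := (ladderMap_inl i x _).trans h.1
    have h2 : ladderMap i x (ancQ r w i.castSucc) = true :=
      (ladderMap_anc_of_ne (by simp [Fin.ext_iff]) x).trans h.2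
    rw [ladderMap, if_pos ⟨h1, h2⟩, ladderMap, if_pos h, flipBit_involutive]
  · have : ladderMap i x = x := if_neg h
    rw [this, this]

/-- The ladder of Toffoli gates computes the conjunction of the search register into the last
ancilla. -/
theorem foldl_ladderMap (x : GQubit r w → Bool) (h0 : x (ancQ r w 0) = true)
    (hs : ∀ i : Fin (3 * r), x (ancQ r w i.succ) = false) :
    (List.finRange (3 * r)).foldl (fun x i => ladderMap i x) x (ancQ r w (Fin.last _)) = true ↔
      ∀ a, x (.inl a) = true := by
  -- Invariant after `p` gates: ancilla `j` is `1` iff `j ≤ p` and the first `j` search qubits are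
  -- all `1`. Ancilla `0` is the empty conjunction.
  have key : ∀ p : ℕ, p ≤ 3 * r →
      (∀ a, ((List.finRange (3 * r)).take p).foldl (fun x i => ladderMap i x) x (.inl a) =
        x (.inl a)) ∧
      ∀ j : Fin (3 * r + 1), ((List.finRange (3 * r)).take p).foldl (fun x i => ladderMap i x) x
        (ancQ r w j) = decide (j.1 ≤ p ∧ ∀ i : Fin (3 * r), i.1 < j.1 → x (flatQ r w i) = true) := by
    intro p
    induction p with
    | zero =>
      intro _
      refine ⟨fun a => rfl, fun j => ?_⟩
      induction j using Fin.cases with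
      | zero => simpa using h0
      | succ i => simpa using hs i
    | succ p ih =>
      intro hp
      obtain ⟨ih1, ih2⟩ := ih (by omega)
      have htake : (List.finRange (3 * r)).take (p + 1) =
          (List.finRange (3 * r)).take p ++ [⟨p, by omega⟩] := by
        rw [List.take_succ_eq_append_getElem (by simpa using hp)]
        simp
      rw [htake]
      simp only [List.foldl_append, List.foldl_cons, List.foldl_nil]
      refine ⟨fun a => by rw [ladderMap_inl, ih1], fun j => ?_⟩
      by_cases hj : j = Fin.succ ⟨p, by omega⟩
      · subst hj
        rw [ladderMap_anc_succ, ih2, ih2, flatQ, ih1]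
        have : ∀ i : Fin (3 * r), i.1 < p + 1 ↔ i = ⟨p, by omega⟩ ∨ i.1 < p := fun i => by
          rw [Fin.ext_iff]; dsimp only; omega
        simp [this, flatQ, or_imp, forall_and]
      · rw [ladderMap_anc_of_ne hj, ih2]
        have : j.1 ≠ p + 1 := fun h => hj (Fin.ext h)
        have h' : j.1 ≤ p + 1 ↔ j.1 ≤ p := by omega
        simp only [h']
  have h := (key (3 * r) le_rfl).2 (Fin.last _)
  rw [List.take_of_length_le (by simp)] at h
  rw [h]
  simp only [Fin.val_last, le_refl, true_and, decide_eq_true_eq]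
  constructor
  · intro h a
    simpa [flatQ] using h (finProdFinEquiv a) (Fin.isLt _)
  · intro h i _
    exact h _

/-- Everything except `negZ` is a basis permutation that is undone later, so only a sign survives.
After the NOT layer the conjunction in the last ancilla says that the original search register is
`0`, and `negZ` gives `+1` exactly then. -/
theorem run_reflection_embed (φ : State (Fin 3 × Fin r)) :
    runCircuit E (reflectionCircuit r w) (embed φ) =
      embed fun a => (if a = (fun _ => false) then 1 else -1) * φ a := by
  funext x
  have hX : ∀ (ψ : State (GQubit r w)) x, runCircuit E (layer r w pauliX) ψ x =
      ψ ((addrList r).foldr (fun i => flipBit (.inl i)) x) := by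
    intro ψ x
    rw [layer_eq]
    exact runCircuit_map_pull E _ (fun i => flipBit (.inl i))
      (fun i ψ x => by rw [Gate.plain_apply, pauliX_apply]) _ ψ x
  set ρ : (GQubit r w → Bool) → GQubit r w → Bool :=
    fun x => (addrList r).foldr (fun i => flipBit (.inl i)) x with hρ
  have hnd : ((addrList r).map (Sum.inl : _ → GQubit r w)).Nodup :=
    nodup_addrList.map Sum.inl_injective
  have hρl : ∀ x a, ρ x (.inl a) = !x (.inl a) := fun x a => by
    rw [hρ]
    dsimp only
    rw [foldr_flipBit _ _ hnd, if_pos (List.mem_map.2 ⟨a, mem_addrList a, rfl⟩)]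
  have hρr : ∀ x q, ρ x (.inr q) = x (.inr q) := fun x q => by
    rw [hρ]
    dsimp only
    rw [foldr_flipBit _ _ hnd, if_neg (by simp)]
  have hρρ : ∀ x, ρ (ρ x) = x := fun x => by
    funext q
    cases q with
    | inl a => rw [hρl, hρl, Bool.not_not]
    | inr q => rw [hρr, hρr]
  have hL := runCircuit_map_pull E (ladderGate r w) ladderMap (ladderGate_apply E)
  simp only [reflectionCircuit, runCircuit_append, runCircuit_cons, runCircuit_nil,
    Gate.plain_apply, ← List.map_reverse]
  rw [hX, pauliX_apply, hL, negZ_apply, hL, pauliX_apply, hX]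
  change _ * embed φ (ρ _) = _
  rw [show (List.foldr (fun i => flipBit (Sum.inl i)) x (addrList r)) = ρ x from rfl,
    List.foldr_reverse, foldr_foldl_of_involutive _ ladderMap_involutive, flipBit_involutive, hρρ]
  by_cases hx : ∀ q, x (.inr q) = false
  · simp only [embed, hx, implies_true, if_true]
    congr 1
    have h0 : flipBit (ancQ r w 0) (ρ x) (ancQ r w 0) = true := by
      rw [flipBit_self, ancQ, hρr, hx]; rfl
    have hs : ∀ i : Fin (3 * r), flipBit (ancQ r w 0) (ρ x) (ancQ r w i.succ) = false := by
      intro i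
      rw [flipBit_of_ne (ancQ_injective.ne (Fin.succ_ne_zero i)), ancQ, hρr, hx]
    have := foldl_ladderMap _ h0 hs
    refine if_congr (this.trans ?_) rfl rfl
    rw [funext_iff]
    refine forall_congr' fun a => ?_
    rw [flipBit_of_ne (by simp [ancQ]), hρl]
    simp
  · simp only [embed_of_not_clean _ hx, mul_zero]

theorem run_groverStep_embed (φ : State (Fin 3 × Fin r)) :
    runCircuit E (groverStep r w) (embed φ) =
      embed fun a => 2 * (∑ b, (if E.isGood (ofBits b) = true then -1 else 1) * φ b) /
        2 ^ (3 * r) - (if E.isGood (ofBits a) = true then -1 else 1) * φ a := by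
  rw [groverStep, runCircuit_append, runCircuit_append, runCircuit_append, run_oracle_embed,
    run_layer_embed, run_reflection_embed, run_layer_embed]
  congr 1
  funext a
  rw [hadamard_reflect_hadamard]
  simp

theorem zeroState_eq_embed : zeroState (GQubit r w) = embed (zeroState (Fin 3 × Fin r)) := by
  funext x
  have h : x = (fun _ => false) ↔
      (∀ q, x (.inr q) = false) ∧ (fun i => x (.inl i)) = fun _ => false := by
    simp only [funext_iff, Sum.forall]
    tauto
  simp only [zeroState, embed, Pi.single_apply, h]
  split_ifs <;> simp_all

/-! ### Grover iteration as a rotation by twice the angle `θ` -/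

theorem card_ofBits_good :
    (Finset.univ.filter fun a : Fin 3 × Fin r → Bool => E.isGood (ofBits a) = true).card =
      E.kSeed := by
  rw [Event.kSeed, Event.goodSeeds]
  refine Finset.card_bij (fun a _ => ofBits a) (fun a ha => by simpa using ha) ?_ ?_
  · intro a _ b _ h
    funext i
    exact congrFun (congrFun h i.1) i.2
  · intro j hj
    exact ⟨fun i => j i.1 i.2, Finset.mem_filter.2 ⟨Finset.mem_univ _, (Finset.mem_filter.1 hj).2⟩, rfl⟩

theorem kSeed_le : E.kSeed ≤ 2 ^ (3 * r) := by
  rw [← card_ofBits_good]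
  refine (Finset.card_le_univ _).trans (le_of_eq ?_)
  simp

/-- The angle `θ` with `sin² θ = k_seed / n³`. -/
def groverAngle : ℝ := Real.arcsin √((E.kSeed : ℝ) / 2 ^ (3 * r))

theorem kSeed_div_nonneg : 0 ≤ (E.kSeed : ℝ) / 2 ^ (3 * r) := by positivity

theorem kSeed_div_le_one : (E.kSeed : ℝ) / 2 ^ (3 * r) ≤ 1 :=
  div_le_one_of_le₀ (by exact_mod_cast kSeed_le E) (by positivity)

theorem sin_groverAngle : Real.sin (groverAngle E) = √((E.kSeed : ℝ) / 2 ^ (3 * r)) :=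
  Real.sin_arcsin (by linarith [Real.sqrt_nonneg ((E.kSeed : ℝ) / 2 ^ (3 * r))])
    (Real.sqrt_le_one.2 (kSeed_div_le_one E))

theorem sin_sq_groverAngle : Real.sin (groverAngle E) ^ 2 = (E.kSeed : ℝ) / 2 ^ (3 * r) := by
  rw [sin_groverAngle, Real.sq_sqrt (kSeed_div_nonneg E)]

/-- The amplitudes after `m` Grover iterations. -/
theorem run_groverCircuit (m : ℕ) : ∃ α β : ℝ,
    finalState E (groverCircuit r w m) =
      embed (fun a => ((if E.isGood (ofBits a) = true then α else β : ℝ) : ℂ)) ∧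
    √(2 ^ (3 * r)) * (α * Real.sin (groverAngle E)) = Real.sin ((2 * m + 1) * groverAngle E) ∧
    √(2 ^ (3 * r)) * (β * Real.cos (groverAngle E)) = Real.cos ((2 * m + 1) * groverAngle E) := by
  set θ := groverAngle E with hθ
  -- The amplitudes stay multiplied by `sin θ` and `cos θ`: dividing would fail when there are no
  -- good seeds or when all triplets are good.
  have hN : (0 : ℝ) < 2 ^ (3 * r) := by positivity
  induction m with
  | zero =>
    refine ⟨(√(2 ^ (3 * r)))⁻¹, (√(2 ^ (3 * r)))⁻¹, ?_, ?_, ?_⟩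
    · rw [groverCircuit, List.replicate_zero, List.flatten_nil, List.append_nil]
      change runCircuit E _ _ = _
      rw [zeroState_eq_embed, run_layer_embed]
      congr 1
      funext a
      rw [tensorApply_hadamard_zeroState]
      simp
    · rw [← mul_assoc, mul_inv_cancel₀ (by positivity)]; simp
    · rw [← mul_assoc, mul_inv_cancel₀ (by positivity)]; simp
  | succ m ih =>
    obtain ⟨α, β, h, hα, hβ⟩ := ih
    have hs : Real.sin θ ^ 2 = (E.kSeed : ℝ) / 2 ^ (3 * r) := sin_sq_groverAngle E
    have hc : Real.cos θ ^ 2 = 1 - (E.kSeed : ℝ) / 2 ^ (3 * r) := by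
      rw [← hs, Real.cos_sq']
    -- Twice the average amplitude after the oracle. Inversion about the average sends `-α` to `A +
    -- α` and `β` to `A - β`, and the addition formulas turn this into a rotation by `2θ`.
    set A : ℝ := 2 * (-(Real.sin θ ^ 2 * α) + Real.cos θ ^ 2 * β)
    refine ⟨A + α, A - β, ?_, ?_, ?_⟩
    · have hrun : finalState E (groverCircuit r w (m + 1)) =
          runCircuit E (groverStep r w) (finalState E (groverCircuit r w m)) := by
        have : groverCircuit r w (m + 1) = groverCircuit r w m ++ groverStep r w := by
          simp [groverCircuit, List.replicate_succ', List.append_assoc]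
        rw [this]
        exact runCircuit_append E _ _ _
      rw [hrun, h, run_groverStep_embed]
      congr 1
      funext a
      have hsum : ∑ b : Fin 3 × Fin r → Bool, (if E.isGood (ofBits b) = true then (-1 : ℂ) else 1) *
          ((if E.isGood (ofBits b) = true then α else β : ℝ) : ℂ) =
          ((-(E.kSeed * α) + (2 ^ (3 * r) - E.kSeed) * β : ℝ) : ℂ) := by
        have h1 : ∀ b : Fin 3 × Fin r → Bool,
            (if E.isGood (ofBits b) = true then (-1 : ℂ) else 1) *
              ((if E.isGood (ofBits b) = true then α else β : ℝ) : ℂ) =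
            β + if E.isGood (ofBits b) = true then -(α + β : ℂ) else 0 := by
          intro b
          split_ifs <;> simp
        simp only [h1, Finset.sum_add_distrib, ← Finset.sum_filter, Finset.sum_const,
          card_ofBits_good]
        simp
        ring
      rw [hsum]
      have hA : 2 * (-(E.kSeed * α) + (2 ^ (3 * r) - E.kSeed) * β : ℝ) / 2 ^ (3 * r) = A := by
        simp only [A, hs, hc]
        field_simp
      have hA' : (2 : ℂ) * ((-(E.kSeed * α) + (2 ^ (3 * r) - E.kSeed) * β : ℝ) : ℂ) /
          2 ^ (3 * r) = (A : ℂ) := by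
        rw [← hA]
        push_cast
        rfl
      rw [hA']
      split_ifs <;> push_cast <;> ring
    · have e : (2 * ((m + 1 : ℕ) : ℝ) + 1) * θ = (2 * m + 1) * θ + 2 * θ := by push_cast; ring
      rw [e, Real.sin_add, ← hα, ← hβ, Real.cos_two_mul, Real.sin_two_mul]
      simp only [A]
      have := Real.sin_sq_add_cos_sq θ
      linear_combination (-2 * √(2 ^ (3 * r)) * α * Real.sin θ) * this
    · have e : (2 * ((m + 1 : ℕ) : ℝ) + 1) * θ = (2 * m + 1) * θ + 2 * θ := by push_cast; ring
      rw [e, Real.cos_add, ← hα, ← hβ, Real.cos_two_mul, Real.sin_two_mul]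
      simp only [A]
      ring

/-- The probability that a run of the Grover circuit with `m` iterations returns the triplet `j`. -/
def outcomeProb (m : ℕ) (j : Triplet r) : ℝ≥0∞ :=
  ∑ x : GQubit r w → Bool with outcome x = j, measureProb E (groverCircuit r w m) x

/-- Only the search register matters for what follows, so the basis states are grouped by the
triplet read off. -/
theorem sum_measureProb_mul (m : ℕ) (h : Triplet r → ℝ≥0∞) :
    ∑ x, measureProb E (groverCircuit r w m) x * h (outcome x) = ∑ j, outcomeProb E m j * h j := by
  rw [← Finset.sum_fiberwise Finset.univ outcome]
  refine Finset.sum_congr rfl fun j _ => ?_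
  rw [outcomeProb, Finset.sum_mul]
  refine Finset.sum_congr rfl fun x hx => ?_
  rw [(Finset.mem_filter.1 hx).2]

theorem sum_outcomeProb (m : ℕ) : ∑ j, outcomeProb E m j = 1 := by
  have := sum_measureProb_mul E m fun _ => 1
  simpa [sum_measureProb] using this.symm

/-- Each good seed is returned with probability `sin² ((2 m + 1) θ) / k_seed`. -/
theorem outcomeProb_of_good (m : ℕ) {j : Triplet r} (hj : E.isGood j = true) :
    outcomeProb E m j = ENNReal.ofReal (Real.sin ((2 * m + 1) * groverAngle E) ^ 2 / E.kSeed) := by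
  obtain ⟨α, β, h, hα, -⟩ := run_groverCircuit E m
  have hk : (0 : ℝ) < E.kSeed := by
    have : 0 < E.kSeed := Finset.card_pos.2 ⟨j, by simpa [Event.goodSeeds] using hj⟩
    exact_mod_cast this
  -- The only basis state with outcome `j` whose other qubits are clean; all others with this
  -- outcome have amplitude `0`.
  set x₀ : GQubit r w → Bool := Sum.elim (fun i => j i.1 i.2) fun _ => false with hx₀
  have ho : outcome x₀ = j := rfl
  rw [outcomeProb, Finset.sum_eq_single x₀]
  · rw [measureProb, h]
    have : embed (w := w) (fun a => ((if E.isGood (ofBits a) = true then α else β : ℝ) : ℂ)) x₀ =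
        α := by
      have hg : E.isGood (ofBits fun i => x₀ (.inl i)) = true := hj
      simp only [embed, hg, if_true]
      exact if_pos fun q => rfl
    rw [this, Complex.norm_real, Real.norm_eq_abs, sq_abs, ← hα, mul_pow, mul_pow,
      Real.sq_sqrt (by positivity), sin_sq_groverAngle]
    congr 1
    field_simp
  · intro x hx hne
    rw [measureProb, h]
    have : ¬ ∀ q, x (.inr q) = false := fun hx' => hne <| by
      funext q
      rcases q with ⟨l, i⟩ | q
      · exact congrFun (congrFun ((Finset.mem_filter.1 hx).2) l) i
      · exact hx' q
    rw [embed_of_not_clean _ this]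
    simp
  · intro hx
    simp [ho] at hx

end Grover

/-! ### Sampling good seeds -/

section Sampling

variable {r w : ℕ} (E : Event r w)

theorem mem_goodSeeds {j : Triplet r} : j ∈ E.goodSeeds ↔ E.isGood j = true := by
  simp [Event.goodSeeds]

/-- Add the triplet `j` to the set `found` if it is a good seed. -/
def addSeed (found : Finset (Triplet r)) (j : Triplet r) : Finset (Triplet r) :=
  if E.isGood j = true then insert j found else found

theorem addSeed_subset {found : Finset (Triplet r)} (h : found ⊆ E.goodSeeds) (j : Triplet r) :
    addSeed E found j ⊆ E.goodSeeds := by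
  unfold addSeed
  split_ifs with hj
  · exact Finset.insert_subset ((mem_goodSeeds E).2 hj) h
  · exact h

theorem card_addSeed_le (found : Finset (Triplet r)) (j : Triplet r) :
    (addSeed E found j).card ≤ found.card + 1 := by
  unfold addSeed
  split_ifs
  · exact Finset.card_insert_le _ _
  · omega

theorem card_le_card_addSeed (found : Finset (Triplet r)) (j : Triplet r) :
    found.card ≤ (addSeed E found j).card := by
  unfold addSeed
  split_ifs
  · exact Finset.card_le_card (Finset.subset_insert _ _)
  · exact le_rfl

theorem addSeed_of_not_mem_sdiff {found : Finset (Triplet r)} {j : Triplet r}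
    (hj : j ∉ E.goodSeeds \ found) : addSeed E found j = found := by
  unfold addSeed
  split_ifs with h
  · refine Finset.insert_eq_of_mem ?_
    by_contra hn
    exact hj (Finset.mem_sdiff.2 ⟨(mem_goodSeeds E).2 h, hn⟩)
  · rfl

theorem addSeed_of_mem_sdiff {found : Finset (Triplet r)} {j : Triplet r}
    (hj : j ∈ E.goodSeeds \ found) : addSeed E found j = insert j found :=
  if_pos ((mem_goodSeeds E).1 (Finset.mem_sdiff.1 hj).1)

/-- The number of Grover iterations `m` is suitable if a good seed is measured with probability at
least `1/2`. -/
def Suitable (m : ℕ) : Prop := 1 / 2 ≤ Real.sin ((2 * m + 1) * groverAngle E) ^ 2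

/-- All good seeds are equally likely, each with probability at least `1 / (2k)`, and `k -
found.card` of them are new. -/
theorem sum_outcomeProb_new {m : ℕ} (hm : Suitable E m) {found : Finset (Triplet r)}
    (hf : found ⊆ E.goodSeeds) :
    ENNReal.ofReal ((E.kSeed - found.card) / (2 * E.kSeed)) ≤
      ∑ j ∈ E.goodSeeds \ found, outcomeProb E m j := by
  have hle : found.card ≤ E.kSeed := Finset.card_le_card hf
  have h : ∀ j ∈ E.goodSeeds \ found, outcomeProb E m j =
      ENNReal.ofReal (Real.sin ((2 * m + 1) * groverAngle E) ^ 2 / E.kSeed) := fun j hj =>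
    outcomeProb_of_good E m ((mem_goodSeeds E).1 (Finset.mem_sdiff.1 hj).1)
  rw [Finset.sum_congr rfl h, Finset.sum_const, Finset.card_sdiff_of_subset hf, nsmul_eq_mul,
    ← ENNReal.ofReal_natCast, ← ENNReal.ofReal_mul (by positivity), ← Event.kSeed,
    Nat.cast_sub hle]
  refine ENNReal.ofReal_le_ofReal ?_
  have h1 : (0 : ℝ) ≤ E.kSeed - found.card := sub_nonneg.2 (by exact_mod_cast hle)
  calc ((E.kSeed : ℝ) - found.card) / (2 * E.kSeed)
      = (E.kSeed - found.card) * ((1 / 2) / E.kSeed) := by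
        rw [div_div, mul_one_div]
    _ ≤ _ := by
        gcongr
        exact hm

/-- The expected decrease of a potential `h` that drops from `b + d` to `b` when a new good seed is
found. -/
theorem sum_outcomeProb_step_le {m : ℕ} (hm : Suitable E m) {found : Finset (Triplet r)}
    (hf : found ⊆ E.goodSeeds) (h : Finset (Triplet r) → ℝ≥0∞) (b d : ℝ≥0∞)
    (h1 : h found ≤ b + d) (h2 : ∀ j ∈ E.goodSeeds \ found, h (insert j found) ≤ b) :
    ∑ j, outcomeProb E m j * h (addSeed E found j) +
      ENNReal.ofReal ((E.kSeed - found.card) / (2 * E.kSeed)) * d ≤ b + d := by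
  calc _ ≤ ∑ j, outcomeProb E m j * h (addSeed E found j) +
        (∑ j ∈ E.goodSeeds \ found, outcomeProb E m j) * d := by
        gcongr
        exact sum_outcomeProb_new E hm hf
    _ = ∑ j, (outcomeProb E m j * h (addSeed E found j) +
          if j ∈ E.goodSeeds \ found then outcomeProb E m j * d else 0) := by
        rw [Finset.sum_add_distrib, Finset.sum_mul]
        congr 1
        rw [← Finset.sum_filter]
        congr 1
        ext j
        simp
    _ ≤ ∑ j, outcomeProb E m j * (b + d) := by
        refine Finset.sum_le_sum fun j _ => ?_
        split_ifs with hj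
        · rw [addSeed_of_mem_sdiff E hj, ← mul_add]
          gcongr
          exact h2 j hj
        · rw [addSeed_of_not_mem_sdiff E hj, add_zero]
          gcongr
    _ = b + d := by rw [← Finset.sum_mul, sum_outcomeProb, one_mul]

/-! ### Suitable numbers of iterations -/

theorem half_le_sin_sq {x : ℝ} (h1 : Real.pi / 4 ≤ x) (h2 : x ≤ 3 * Real.pi / 4) :
    1 / 2 ≤ Real.sin x ^ 2 := by
  have h := Real.cos_nonpos_of_pi_div_two_le_of_le (x := 2 * x) (by linarith) (by linarith)
  rw [Real.sin_sq_eq_half_sub]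
  linarith

theorem groverAngle_le : groverAngle E ≤ Real.pi / 2 := Real.arcsin_le_pi_div_two _

theorem sqrt_le_groverAngle : √((E.kSeed : ℝ) / 2 ^ (3 * r)) ≤ groverAngle E := by
  rw [← sin_groverAngle]
  exact Real.sin_le (Real.arcsin_nonneg.2 (Real.sqrt_nonneg _))

variable {E} in
theorem sqrt_kSeed_pos (hk : 0 < E.kSeed) : 0 < √((E.kSeed : ℝ) / 2 ^ (3 * r)) := by
  have : (0 : ℝ) < E.kSeed := by exact_mod_cast hk
  positivity

variable {E} in
theorem groverAngle_pos (hk : 0 < E.kSeed) : 0 < groverAngle E :=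
  (sqrt_kSeed_pos hk).trans_le (sqrt_le_groverAngle E)

theorem groverIterations_eq :
    groverIterations r E.kSeed = ⌊Real.pi / (4 * groverAngle E)⌋₊ := by
  rw [groverIterations, groverAngle, ← pow_mul, mul_comm r 3]

variable {E} in
-- Without rounding, `2mθ` would be `π/2`. Rounding down and the extra `θ` leave `(2m+1)θ` within
-- `θ` of `π/2`, which suffices for `θ ≤ π/4`. For larger `θ` the floor is `0`, and `θ` itself lies
-- in `(π/4, π/2]`.
theorem suitable_groverIterations (hk : 0 < E.kSeed) :
    Suitable E (groverIterations r E.kSeed) := by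
  have hθ := groverAngle_pos hk
  have hθ' := groverAngle_le E
  have hpi := Real.pi_pos
  rw [Suitable, groverIterations_eq]
  set θ := groverAngle E
  set u := Real.pi / (4 * θ)
  have hu : u * θ = Real.pi / 4 := by
    simp only [u]
    field_simp
  have h1 : (⌊u⌋₊ : ℝ) ≤ u := Nat.floor_le (by positivity)
  have h2 : u < ⌊u⌋₊ + 1 := Nat.lt_floor_add_one u
  by_cases h : θ ≤ Real.pi / 4
  · apply half_le_sin_sq <;> nlinarith
  · have h0 : ⌊u⌋₊ = 0 := by
      rw [Nat.floor_eq_zero]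
      by_contra h'
      nlinarith
    rw [h0]
    apply half_le_sin_sq <;> push_cast <;> linarith

variable {E} in
-- From `θ ≥ sin θ = √(k/N)` and `π ≤ 4`.
theorem groverIterations_le (hk : 0 < E.kSeed) :
    (groverIterations r E.kSeed : ℝ) ≤ √(2 ^ (3 * r) / E.kSeed) := by
  have hθ := groverAngle_pos hk
  have hs := sqrt_kSeed_pos hk
  rw [groverIterations_eq]
  calc (⌊Real.pi / (4 * groverAngle E)⌋₊ : ℝ) ≤ Real.pi / (4 * groverAngle E) :=
        Nat.floor_le (div_nonneg Real.pi_pos.le (by positivity))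
    _ ≤ Real.pi / (4 * √((E.kSeed : ℝ) / 2 ^ (3 * r))) := by
        gcongr
        exact sqrt_le_groverAngle E
    _ ≤ 1 / √((E.kSeed : ℝ) / 2 ^ (3 * r)) := by
        rw [div_le_div_iff₀ (by positivity) hs]
        nlinarith [Real.pi_le_four]
    _ = _ := by
        rw [one_div, ← Real.sqrt_inv, inv_div]

/-! ### Gate counts -/

/-- A bound for the constant factor in the cost of a Grover iteration. -/
def CostModel.stepFactor (κ : CostModel) : ℕ := 6 * κ.qram + κ.seed + κ.test + 24

theorem circuitCost_append {Q : Type} (κ : CostModel) (c d : Circuit r w Q) :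
    circuitCost κ (c ++ d) = circuitCost κ c + circuitCost κ d := by
  simp [circuitCost]

theorem circuitCost_layer (κ : CostModel) (U : Matrix.unitaryGroup Bool ℂ) :
    circuitCost κ (layer r w U) = 3 * r := by
  simp [circuitCost, layer, Gate.plain, Gate.cost, Function.comp_def]

theorem circuitCost_groverStep (κ : CostModel) :
    circuitCost κ (groverStep r w) = 6 * (κ.qram * r) + κ.seed + 18 * r + 3 := by
  have h1 : circuitCost κ (oracleCircuit r w) = 6 * (κ.qram * r) + κ.seed := by
    simp [circuitCost, oracleCircuit, loadGate, seedGate, Gate.plain, Gate.cost]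
    ring
  have h2 : circuitCost κ (reflectionCircuit r w) = 12 * r + 3 := by
    have h3 : circuitCost κ ((List.finRange (3 * r)).map (ladderGate r w)) = 3 * r := by
      simp [circuitCost, ladderGate, Gate.cost, Function.comp_def]
    have h4 : circuitCost κ ((List.finRange (3 * r)).map (ladderGate r w)).reverse = 3 * r := by
      simpa [circuitCost] using h3
    have h5 : ∀ (U : Matrix.unitaryGroup Bool ℂ) (t : GQubit r w),
        circuitCost (r := r) (w := w) κ [Gate.plain (.oneQubit U t)] = 1 := by
      intro U t
      simp [circuitCost, Gate.plain, Gate.cost]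
    simp only [reflectionCircuit, circuitCost_append, circuitCost_layer, h3, h4, h5]
    ring
  simp only [groverStep, circuitCost_append, circuitCost_layer, h1, h2]
  ring

/-- Since `r ≥ 1`, each of the `m` steps costs at most `(6 c₁ + c₂ + 21) r`; the extra unit in `m +
1` pays for the initial Hadamard layer and the test. -/
theorem circuitCost_groverCircuit_le (hr : 1 ≤ r) (κ : CostModel) (m : ℕ) :
    circuitCost κ (groverCircuit r w m) + κ.test ≤ κ.stepFactor * r * (m + 1) := by
  have h : circuitCost κ (List.replicate m (groverStep r w)).flatten =
      m * (6 * (κ.qram * r) + κ.seed + 18 * r + 3) := by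
    induction m with
    | zero => simp [circuitCost]
    | succ m ih =>
      rw [List.replicate_succ, List.flatten_cons, circuitCost_append, ih, circuitCost_groverStep]
      ring
  rw [groverCircuit, circuitCost_append, circuitCost_layer, h, CostModel.stepFactor]
  obtain ⟨r, rfl⟩ : ∃ r', r = r' + 1 := ⟨r - 1, by omega⟩
  have : 0 ≤ (κ.seed + κ.test) * r * m := Nat.zero_le _
  nlinarith [Nat.zero_le ((κ.seed + κ.test) * r), Nat.zero_le (κ.qram * (r + 1)),
    Nat.zero_le (κ.test * m), Nat.zero_le (r * m), Nat.zero_le (κ.test * m * r)]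

end Sampling

/-! ### Analysis of quantum seed generation -/

section Seeding

variable {r w : ℕ} (count : QAlg r w ℕ) (κ : CostModel) (E : Event r w)

variable {count} in
theorem act_searching_of_lt {k : ℕ} {found : Finset (Triplet r)} (h : found.card < k) :
    (quantumSeeding count).act (.searching k found) =
      .measure (GQubit r w) (groverCircuit r w (groverIterations r k))
        fun x => .testing k found (outcome x) := by
  change searchAction k found = _
  rw [searchAction, if_pos h]
  rfl

variable {count} in
theorem act_searching_of_le {k : ℕ} {found : Finset (Triplet r)} (h : k ≤ found.card) :
    (quantumSeeding count).act (.searching k found) = .halt found := by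
  change searchAction k found = _
  rw [searchAction, if_neg h.not_gt]
  rfl

theorem act_testing (k : ℕ) (found : Finset (Triplet r)) (j : Triplet r) :
    (quantumSeeding count).act (.testing k found j) =
      .test j fun b => .searching k (if b = true then insert j found else found) := rfl

/-- One round of the loop, search and test together, as a recursion on the set of seeds found. -/
theorem value_searching_of_lt {k : ℕ} {found : Finset (Triplet r)} (h : found.card < k)
    (f : Finset (Triplet r) → ℕ → ℝ≥0∞) (t : ℕ) :
    (quantumSeeding count).value κ E f (.searching k found) t =
      ∑ j, outcomeProb E (groverIterations r k) j *
        (quantumSeeding count).value κ E f (.searching k (addSeed E found j))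
          (t + circuitCost κ (groverCircuit r w (groverIterations r k)) + κ.test) := by
  rw [QAlg.value_measure κ E (act_searching_of_lt h), ← sum_measureProb_mul]
  refine Finset.sum_congr rfl fun x _ => ?_
  rw [QAlg.value_test κ E (act_testing count k found (outcome x))]
  rfl

theorem QAlg.expectFrom_congr_act {α : Type} {A : QAlg r w α} {s s' : A.S}
    (h : A.act s = A.act s') (f : α → ℕ → ℝ≥0∞) (N t : ℕ) :
    A.expectFrom κ E f (N + 1) s t = A.expectFrom κ E f (N + 1) s' t := by
  simp only [QAlg.expectFrom, h]

/-- Needed because passing from counting to searching takes no action: the halting states of the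
subroutine and the head of the loop have the same action. -/
theorem QAlg.value_congr_act {α : Type} {A : QAlg r w α} {s s' : A.S}
    (h : A.act s = A.act s') (f : α → ℕ → ℝ≥0∞) (t : ℕ) :
    A.value κ E f s t = A.value κ E f s' t := by
  simp only [QAlg.value_eq_iSup_succ, QAlg.expectFrom_congr_act κ E h]

/-- The counting subroutine runs first, and its output determines the loop. -/
theorem value_counting (f : Finset (Triplet r) → ℕ → ℝ≥0∞) (s : count.S) (t : ℕ) :
    (quantumSeeding count).value κ E f (.counting s) t =
      count.value κ E
        (fun k t => (quantumSeeding count).value κ E f (.searching k ∅) t) s t := by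
  have hhalt : ∀ s k, count.act s = .halt k →
      (quantumSeeding count).act (.counting s) = (quantumSeeding count).act (.searching k ∅) := by
    intro s k h
    simp only [quantumSeeding, h]
  have hmeas : ∀ s (Q : Type) (_ : Fintype Q) (_ : DecidableEq Q) (c : Circuit r w Q)
      (next : (Q → Bool) → count.S), count.act s = .measure Q c next →
      (quantumSeeding count).act (.counting s) = .measure Q c fun x => .counting (next x) := by
    intro s Q _ _ c next h
    simp only [quantumSeeding, h]
  have htest : ∀ s j (next : Bool → count.S), count.act s = .test j next →
      (quantumSeeding count).act (.counting s) = .test j fun b => .counting (next b) := by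
    intro s j next h
    simp only [quantumSeeding, h]
  apply le_antisymm
  -- The same budget `N` suffices for the subroutine alone, with the loop after it left unbounded.
  · refine iSup_le fun N => le_trans ?_ (count.expectFrom_le_value κ E _ N s t)
    induction N generalizing s t with
    | zero => simp [QAlg.expectFrom]
    | succ N ih =>
      refine QAlg.act_cases s (fun k h => ?_) (fun Q _ _ c next h => ?_) (fun j next h => ?_)
      · rw [QAlg.expectFrom_halt κ E h, QAlg.expectFrom_congr_act κ E (hhalt s k h)]
        exact QAlg.expectFrom_le_value _ _ _ _ _ _ _
      · rw [QAlg.expectFrom_measure κ E h,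
          QAlg.expectFrom_measure κ E (hmeas s Q _ _ c next h)]
        gcongr
        exact ih _ _
      · rw [QAlg.expectFrom_test κ E h, QAlg.expectFrom_test κ E (htest s j next h)]
        exact ih _ _
  · refine iSup_le fun N => ?_
    induction N generalizing s t with
    | zero => simp [QAlg.expectFrom]
    | succ N ih =>
      refine QAlg.act_cases s (fun k h => ?_) (fun Q _ _ c next h => ?_) (fun j next h => ?_)
      · rw [QAlg.expectFrom_halt κ E h]
        exact (QAlg.value_congr_act κ E (hhalt s k h) f t).ge
      · rw [QAlg.expectFrom_measure κ E h, QAlg.value_measure κ E (hmeas s Q _ _ c next h)]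
        gcongr
        exact ih _ _
      · rw [QAlg.expectFrom_test κ E h, QAlg.value_test κ E (htest s j next h)]
        exact ih _ _

/-- If the estimate is wrong, the loop does not halt with the set of all good seeds. -/
theorem value_searching_of_ne {k : ℕ} (hk : k ≠ E.kSeed) {f : Finset (Triplet r) → ℕ → ℝ≥0∞}
    (hf : ∀ a t, a ≠ E.goodSeeds → f a t = 0) (t : ℕ) :
    (quantumSeeding count).value κ E f (.searching k ∅) t = 0 := by
  -- A round adds at most one seed, so `found.card ≤ k` persists and a halting run has exactly `k`
  -- seeds, hence not the full set.
  have key : ∀ N : ℕ, ∀ found : Finset (Triplet r), found.card ≤ k → ∀ t,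
      (quantumSeeding count).expectFrom κ E f N (.searching k found) t = 0 ∧
      ∀ j, found.card < k →
        (quantumSeeding count).expectFrom κ E f N (.testing k found j) t = 0 := by
    intro N
    induction N with
    | zero => intro found _ t; simp [QAlg.expectFrom]
    | succ N ih =>
      intro found hc t
      constructor
      · rcases hc.lt_or_eq with h | h
        · rw [QAlg.expectFrom_measure κ E (act_searching_of_lt h)]
          exact Finset.sum_eq_zero fun x _ => by rw [(ih found hc _).2 _ h, mul_zero]
        · rw [QAlg.expectFrom_halt κ E (act_searching_of_le h.ge)]
          refine hf _ _ fun h' => hk ?_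
          rw [← h, h', Event.kSeed]
      · intro j h
        rw [QAlg.expectFrom_test κ E (act_testing count k found j)]
        exact (ih (addSeed E found j) ((card_addSeed_le E found j).trans h) _).1
  exact ENNReal.iSup_eq_zero.2 fun N => (key N ∅ (by simp) t).1

theorem eq_goodSeeds_of_card_le {found : Finset (Triplet r)} (hf : found ⊆ E.goodSeeds)
    (h : E.kSeed ≤ found.card) : found = E.goodSeeds :=
  Finset.eq_of_subset_of_card_le hf h

theorem QAlg.value_le_one {α : Type} (A : QAlg r w α) {f : α → ℕ → ℝ≥0∞}
    (hf : ∀ a t, f a t ≤ 1) (s : A.S) (t : ℕ) : A.value κ E f s t ≤ 1 := by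
  refine iSup_le fun N => ?_
  induction N generalizing s t with
  | zero => simp [QAlg.expectFrom]
  | succ N ih =>
    refine QAlg.act_cases s (fun a h => ?_) (fun Q _ _ c next h => ?_) (fun j next h => ?_)
    · rw [QAlg.expectFrom_halt κ E h]
      exact hf _ _
    · rw [QAlg.expectFrom_measure κ E h, ← sum_measureProb E c]
      refine Finset.sum_le_sum fun x _ => ?_
      exact mul_le_of_le_one_right (zero_le) (ih _ _)
    · rw [QAlg.expectFrom_test κ E h]
      exact ih _ _

/-- If the estimate is correct, the loop halts with the set of all good seeds almost surely. -/
theorem value_searching_kSeed {found : Finset (Triplet r)} (hf : found ⊆ E.goodSeeds) (t : ℕ) :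
    (quantumSeeding count).value κ E (fun a _ => if a = E.goodSeeds then 1 else 0)
      (.searching E.kSeed found) t = 1 := by
  induction hn : E.kSeed - found.card generalizing found t with
  | zero =>
    rw [QAlg.value_halt κ E (act_searching_of_le (by omega)),
      if_pos (eq_goodSeeds_of_card_le E hf (by omega))]
  | succ n ih =>
    have hlt : found.card < E.kSeed := by omega
    set V : Finset (Triplet r) → ℝ≥0∞ := fun S =>
      (quantumSeeding count).value κ E (fun a _ => if a = E.goodSeeds then 1 else 0)
        (.searching E.kSeed S) 0
    have hV : ∀ S t, (quantumSeeding count).value κ E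
        (fun a _ => if a = E.goodSeeds then 1 else 0) (.searching E.kSeed S) t = V S :=
      fun S t => QAlg.value_time_irrel _ κ E (fun a => if a = E.goodSeeds then 1 else 0) _ _ _
    have hV1 : ∀ S, V S ≤ 1 := fun S =>
      QAlg.value_le_one κ E _ (fun a _ => by split_ifs <;> simp) _ _
    have hstep := value_searching_of_lt count κ E hlt
      (fun a _ => if a = E.goodSeeds then 1 else 0) t
    simp only [hV] at hstep ⊢
    have hnew : ∀ j ∈ E.goodSeeds \ found, 1 - V (insert j found) ≤ 0 := by
      intro j hj
      rw [Finset.mem_sdiff] at hj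
      have : V (insert j found) = 1 :=
        ih (Finset.insert_subset hj.1 hf) 0 (by rw [Finset.card_insert_of_notMem hj.2]; omega)
      rw [this, tsub_self]
    -- The potential is the failure probability `q = 1 - V found`, which by induction is `0` once a
    -- new seed is found. The recursion then gives `q + c q ≤ q` with `c > 0`, and `q` is finite, so
    -- `q = 0`.
    have hdrop := sum_outcomeProb_step_le E (suitable_groverIterations (by omega)) hf
      (fun S => 1 - V S) 0 (1 - V found) (by simp) hnew
    have hge : 1 - V found ≤ ∑ j, outcomeProb E (groverIterations r E.kSeed) j *
        (1 - V (addSeed E found j)) := by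
      rw [tsub_le_iff_right, hstep, ← Finset.sum_add_distrib]
      simp only [← mul_add, tsub_add_cancel_of_le (hV1 _), mul_one, sum_outcomeProb, le_refl]
    have h0 : ENNReal.ofReal ((E.kSeed - found.card) / (2 * E.kSeed)) * (1 - V found) = 0 := by
      have h := (add_le_add_left hge _).trans hdrop
      rw [zero_add] at h
      have hfin : 1 - V found ≠ ⊤ := (tsub_le_self.trans_lt ENNReal.one_lt_top).ne
      have h' : (1 - V found) + ENNReal.ofReal ((E.kSeed - found.card) / (2 * E.kSeed)) *
        (1 - V found) ≤ (1 - V found) + 0 := h.trans (add_zero _).ge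
      exact nonpos_iff_eq_zero.1 <| (ENNReal.add_le_add_iff_left hfin).1 h'
    have hpos : (0 : ℝ) < (E.kSeed - found.card) / (2 * E.kSeed) := by
      have h1 : (found.card : ℝ) < E.kSeed := Nat.cast_lt.2 hlt
      have h2 : (0 : ℝ) ≤ found.card := Nat.cast_nonneg _
      exact div_pos (by linarith) (by linarith)
    rcases mul_eq_zero.1 h0 with h | h
    · exact absurd h (ENNReal.ofReal_pos.2 hpos).ne'
    · exact le_antisymm (hV1 _) (tsub_eq_zero_iff_le.1 h)

/-! ### Running time of the loop -/

/-- The expected number of Grover searches until the remaining `n` among `k` good seeds have been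
found. -/
def expectedSearches (k n : ℕ) : ℝ≥0∞ :=
  ∑ i ∈ Finset.range n, ENNReal.ofReal (2 * k / (i + 1))

/-- Coupon collector: a new seed lowers the potential `W` by the reciprocal of the guaranteed chance
of finding one, so each search lowers `W` by at least `1` on average and pays for itself. -/
theorem value_searching_time_le {found : Finset (Triplet r)} (hf : found ⊆ E.goodSeeds) (t : ℕ) :
    (quantumSeeding count).value κ E (fun _ t => (t : ℝ≥0∞)) (.searching E.kSeed found) t ≤
      t + (circuitCost κ (groverCircuit r w (groverIterations r E.kSeed)) + κ.test : ℕ) *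
        expectedSearches E.kSeed (E.kSeed - found.card) := by
  set c := circuitCost κ (groverCircuit r w (groverIterations r E.kSeed))
  set W : Finset (Triplet r) → ℝ≥0∞ := fun S => expectedSearches E.kSeed (E.kSeed - S.card) with hW
  have key : ∀ N : ℕ, ∀ found : Finset (Triplet r), found ⊆ E.goodSeeds → ∀ t : ℕ,
      (quantumSeeding count).expectFrom κ E (fun _ t => (t : ℝ≥0∞)) N
        (.searching E.kSeed found) t ≤ t + (c + κ.test : ℕ) * W found ∧
      ∀ j, (quantumSeeding count).expectFrom κ E (fun _ t => (t : ℝ≥0∞)) N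
        (.testing E.kSeed found j) t ≤
          t + κ.test + (c + κ.test : ℕ) * W (addSeed E found j) := by
    intro N
    induction N with
    | zero => intro found _ t; simp [QAlg.expectFrom]
    | succ N ih =>
      intro found hf t
      constructor
      · rcases lt_or_ge found.card E.kSeed with h | h
        · rw [QAlg.expectFrom_measure κ E (act_searching_of_lt h)]
          -- The last summand of `W` has index `k - found.card - 1`, so its denominator is the
          -- number of missing seeds.
          have hd : W found = expectedSearches E.kSeed (E.kSeed - (found.card + 1)) +
              ENNReal.ofReal (2 * E.kSeed / (E.kSeed - found.card)) := by
            rw [hW]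
            dsimp only
            have : E.kSeed - found.card = E.kSeed - (found.card + 1) + 1 := by omega
            rw [this, expectedSearches, Finset.sum_range_succ, expectedSearches]
            congr 3
            rw [Nat.cast_sub h]
            push_cast
            ring
          have hdrop := sum_outcomeProb_step_le E (suitable_groverIterations (by omega)) hf
            W _ _ hd.le (fun j hj => by
              rw [hW]
              dsimp only
              rw [Finset.card_insert_of_notMem (Finset.mem_sdiff.1 hj).2])
          have h1 : (found.card : ℝ) < E.kSeed := by exact_mod_cast h
          have h2 : (0 : ℝ) ≤ found.card := by positivity
          have h3 : (0 : ℝ) < E.kSeed - found.card := by linarith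
          have h4 : (0 : ℝ) < E.kSeed := by linarith
          rw [← ENNReal.ofReal_mul (by positivity), div_mul_div_cancel₀' (by positivity),
            div_self (by positivity), ENNReal.ofReal_one, ← hd] at hdrop
          calc _ ≤ ∑ x, measureProb E (groverCircuit r w (groverIterations r E.kSeed)) x *
                ((((t + c : ℕ) : ℝ≥0∞) + κ.test) +
                  (c + κ.test : ℕ) * W (addSeed E found (outcome x))) := by
                gcongr with x
                exact (ih found hf _).2 _
            _ = t + (c + κ.test : ℕ) *
                (∑ j, outcomeProb E (groverIterations r E.kSeed) j * W (addSeed E found j) + 1) := by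
                rw [sum_measureProb_mul E _ fun j => (((t + c : ℕ) : ℝ≥0∞) + κ.test) +
                  (c + κ.test : ℕ) * W (addSeed E found j)]
                simp only [mul_add, Finset.sum_add_distrib, ← Finset.sum_mul, sum_outcomeProb,
                  one_mul, mul_left_comm _ ((c + κ.test : ℕ) : ℝ≥0∞), ← Finset.mul_sum]
                push_cast
                ring
            _ ≤ _ := by gcongr
        · rw [QAlg.expectFrom_halt κ E (act_searching_of_le h)]
          exact le_self_add
      · intro j
        rw [QAlg.expectFrom_test κ E (act_testing count _ found j)]
        refine ((ih (addSeed E found j) (addSeed_subset E hf j) _).1).trans (le_of_eq ?_)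
        push_cast
        rfl
  exact iSup_le fun N => (key N found hf t).1

/-- The harmonic sum is at most `1 + log k`, and `log k ≤ 3r` because `k ≤ 2^(3r)`; `r ≥ 1` absorbs
the `1`. -/
theorem sum_range_inv_le (hr : 1 ≤ r) :
    ∑ i ∈ Finset.range E.kSeed, ((i : ℝ) + 1)⁻¹ ≤ 4 * r := by
  have h := harmonic_le_one_add_log E.kSeed
  have h' : ((harmonic E.kSeed : ℚ) : ℝ) = ∑ i ∈ Finset.range E.kSeed, ((i : ℝ) + 1)⁻¹ := by
    rw [harmonic]
    push_cast
    rfl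
  rw [h'] at h
  have hr' : (1 : ℝ) ≤ r := by exact_mod_cast hr
  have hlog : Real.log E.kSeed ≤ 3 * r := by
    rcases Nat.eq_zero_or_pos E.kSeed with h0 | h0
    · rw [h0, Nat.cast_zero, Real.log_zero]
      positivity
    · calc Real.log E.kSeed ≤ Real.log (2 ^ (3 * r)) :=
            Real.log_le_log (by exact_mod_cast h0) (by exact_mod_cast kSeed_le E)
        _ = 3 * r * Real.log 2 := by rw [Real.log_pow]; push_cast; ring
        _ ≤ 3 * r := mul_le_of_le_one_right (by positivity) (by linarith [Real.log_two_lt_d9])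
  linarith

/-- If the estimate is correct, the expected time of the loop is `Õ(√(n³ k_seed))`. -/
theorem value_searching_empty_le (hr : 1 ≤ r) (t : ℕ) :
    (quantumSeeding count).value κ E (fun _ t => (t : ℝ≥0∞)) (.searching E.kSeed ∅) t ≤
      t + ENNReal.ofReal (16 * κ.stepFactor * r ^ 2 * √(2 ^ (3 * r) * E.kSeed)) := by
  refine (value_searching_time_le count κ E (Finset.empty_subset _) t).trans ?_
  gcongr
  rw [Finset.card_empty, Nat.sub_zero, expectedSearches,
    ← ENNReal.ofReal_sum_of_nonneg fun _ _ => by positivity, ← ENNReal.ofReal_natCast,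
    ← ENNReal.ofReal_mul (by positivity)]
  refine ENNReal.ofReal_le_ofReal ?_
  rcases Nat.eq_zero_or_pos E.kSeed with h0 | h0
  · simp [h0]
  have hk : (0 : ℝ) < E.kSeed := by exact_mod_cast h0
  have hc : ((circuitCost κ (groverCircuit r w (groverIterations r E.kSeed)) + κ.test : ℕ) : ℝ) ≤
      κ.stepFactor * r * (2 * √(2 ^ (3 * r) / E.kSeed)) := by
    calc _ ≤ ((κ.stepFactor * r * (groverIterations r E.kSeed + 1) : ℕ) : ℝ) := by
          exact_mod_cast circuitCost_groverCircuit_le hr κ _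
      _ = κ.stepFactor * r * ((groverIterations r E.kSeed : ℝ) + 1) := by push_cast; ring
      _ ≤ _ := by
          gcongr
          -- As `k ≤ N`, the extra `1` in `m + 1` is absorbed by doubling `√(N/k)`.
          have h1 : 1 ≤ √((2 : ℝ) ^ (3 * r) / E.kSeed) := by
            rw [Real.one_le_sqrt, one_le_div hk]
            exact_mod_cast kSeed_le E
          linarith [groverIterations_le h0]
  have hs : √((2 : ℝ) ^ (3 * r) * E.kSeed) = √(2 ^ (3 * r) / E.kSeed) * E.kSeed := by
    rw [← Real.sqrt_sq hk.le, ← Real.sqrt_mul (by positivity), Real.sqrt_sq hk.le]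
    congr 1
    field_simp
  have hsum : ∑ i ∈ Finset.range E.kSeed, 2 * (E.kSeed : ℝ) / (i + 1) ≤ 2 * E.kSeed * (4 * r) := by
    simp only [div_eq_mul_inv, ← Finset.mul_sum]
    gcongr
    exact sum_range_inv_le E hr
  -- Cost of a search times expected number of searches; the constant is `16 = 2 · 2 · 4`.
  calc _ ≤ (κ.stepFactor * r * (2 * √(2 ^ (3 * r) / E.kSeed))) * (2 * E.kSeed * (4 * r)) := by
        gcongr
    _ = _ := by rw [hs]; ring

theorem prob_quantumSeeding :
    (quantumSeeding count).prob κ E (fun seeds _ => seeds = E.goodSeeds) =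
      count.prob κ E fun k _ => k = E.kSeed := by
  have h := value_counting count κ E (fun a _ => if a = E.goodSeeds then 1 else 0) count.start 0
  have h' : (fun k t => (quantumSeeding count).value κ E
      (fun a _ => if a = E.goodSeeds then 1 else 0) (.searching k ∅) t) =
      fun k _ => if k = E.kSeed then 1 else 0 := by
    funext k t
    split_ifs with hk
    · rw [hk]
      exact value_searching_kSeed count κ E (Finset.empty_subset _) t
    · exact value_searching_of_ne count κ E hk (fun a t ha => if_neg ha) t
  rw [h'] at h
  exact (QAlg.prob_eq_value _ κ E _).trans (h.trans (QAlg.prob_eq_value _ κ E _).symm)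

/-- The subroutine is charged over all its runs, but the loop only where the count is correct, since
a wrong count contributes nothing to the event. -/
theorem timeOn_quantumSeeding_le (hr : 1 ≤ r) :
    (quantumSeeding count).timeOn κ E (fun seeds => seeds = E.goodSeeds) ≤
      count.expectedTime κ E +
        ENNReal.ofReal (16 * κ.stepFactor * r ^ 2 * √(2 ^ (3 * r) * E.kSeed)) *
          count.prob κ E fun k _ => k = E.kSeed := by
  set R := ENNReal.ofReal (16 * κ.stepFactor * r ^ 2 * √(2 ^ (3 * r) * E.kSeed))
  have h := value_counting count κ E (fun a t => if a = E.goodSeeds then (t : ℝ≥0∞) else 0)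
    count.start 0
  have hle : ∀ k t, (quantumSeeding count).value κ E
      (fun a t => if a = E.goodSeeds then (t : ℝ≥0∞) else 0) (.searching k ∅) t ≤
      t + R * if k = E.kSeed then 1 else 0 := by
    intro k t
    split_ifs with hk
    · rw [hk, mul_one]
      refine (QAlg.value_mono _ κ E (fun a t => ?_) _ _).trans
        (value_searching_empty_le count κ E hr t)
      split_ifs <;> simp
    · rw [value_searching_of_ne count κ E hk (fun a t ha => if_neg ha) t]
      exact zero_le
  have h2 := (h.le.trans (count.value_mono κ E hle count.start 0)).trans
    (count.value_add_le κ E _ _ _ _)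
  rw [QAlg.value_const_mul] at h2
  have h3 : count.value κ E (fun _ t => (t : ℝ≥0∞)) count.start 0 ≤ count.expectedTime κ E :=
    iSup_mono fun N => by simpa using count.expectFrom_time_le κ E N count.start 0
  have h4 := h2.trans (add_le_add_left h3 _)
  rw [QAlg.prob_eq_value]
  exact (QAlg.timeOn_eq_value _ κ E _).trans_le h4

end Seeding

/-! ### A quantum counting algorithm

The algorithm collects good seeds by Grover search. In phase `g` it runs Grover circuits whose
numbers of iterations suit every number of good seeds above `2 ^ g / 2`, so often that `2 ^ g + 1`
good seeds, or all of them, are found with high probability; if at most `2 ^ g` good seeds have been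
found after this phase, it returns their number. -/

/-- An instruction of the counting algorithm: run the Grover circuit with `m` iterations, or halt
if at most `b` good seeds have been found. -/
inductive CountInstr : Type
  | run (m : ℕ)
  | check (b : ℕ)

/-- The classical states of the counting algorithm: the remaining instructions, the good seeds found
so far, and possibly a triplet that is about to be tested. -/
inductive CountState (r : ℕ) : Type
  | running (l : List CountInstr) (found : Finset (Triplet r))
  | testing (l : List CountInstr) (found : Finset (Triplet r)) (j : Triplet r)

/-- The next action, given the remaining instructions and the good seeds found so far. -/
def countAction {r w : ℕ} :
    List CountInstr → Finset (Triplet r) → Action r w (CountState r) ℕ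
  | [], found => .halt found.card
  | .run m :: l, found =>
      .measure (GQubit r w) (groverCircuit r w m) fun x => .testing l found (outcome x)
  | .check b :: l, found => if found.card ≤ b then .halt found.card else countAction l found

/-- The algorithm that carries out the given instructions. -/
def countingProgram (r w : ℕ) (l : List CountInstr) : QAlg r w ℕ where
  S := CountState r
  start := .running l ∅
  act
    | .running l found => countAction l found
    | .testing l found j =>
      .test j fun b => .running l (if b = true then insert j found else found)

/-- The numbers of Grover iterations in phase `g`. -/
def phaseRuns (r g : ℕ) : List ℕ :=
  (List.range (Nat.log 9 (16 * 2 ^ (3 * r - g)) + 1)).flatMap fun j =>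
    List.replicate (16 * r * (2 ^ g + 1)) ((3 ^ j - 1) / 2)

/-- The instructions of the `n` phases from phase `g` on. -/
def phases (r : ℕ) : ℕ → ℕ → List CountInstr
  | _, 0 => []
  | g, n + 1 => (phaseRuns r g).map .run ++ .check (2 ^ g) :: phases r (g + 1) n

/-- The counting algorithm. -/
def seedCount (r w : ℕ) : QAlg r w ℕ := countingProgram r w (phases r 0 (3 * r + 1))

section Counting

variable {r w : ℕ} (κ : CostModel) (E : Event r w) (l₀ : List CountInstr)

theorem act_run (m : ℕ) (l : List CountInstr) (found : Finset (Triplet r)) :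
    (countingProgram r w l₀).act (.running (.run m :: l) found) =
      .measure (GQubit r w) (groverCircuit r w m) fun x => .testing l found (outcome x) := rfl

theorem act_count_testing (l : List CountInstr) (found : Finset (Triplet r)) (j : Triplet r) :
    (countingProgram r w l₀).act (.testing l found j) =
      .test j fun b => .running l (if b = true then insert j found else found) := rfl

variable {l₀} in
theorem act_check_of_le {b : ℕ} (l : List CountInstr) {found : Finset (Triplet r)}
    (h : found.card ≤ b) :
    (countingProgram r w l₀).act (.running (.check b :: l) found) = .halt found.card :=
  if_pos h

variable {l₀} in
-- A passed check is resolved inside `countAction`, so it consumes no action and no time.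
theorem act_check_of_lt {b : ℕ} (l : List CountInstr) {found : Finset (Triplet r)}
    (h : b < found.card) :
    (countingProgram r w l₀).act (.running (.check b :: l) found) =
      (countingProgram r w l₀).act (.running l found) :=
  if_neg h.not_ge

/-- The probability that the number of good seeds is returned if the instructions `l` remain and
the good seeds in `found` have been found. -/
def countSuccess (l : List CountInstr) (found : Finset (Triplet r)) : ℝ≥0∞ :=
  (countingProgram r w l₀).value κ E (fun k _ => if k = E.kSeed then 1 else 0)
    (.running l found) 0

theorem countSuccess_run (m : ℕ) (l : List CountInstr) (found : Finset (Triplet r)) :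
    countSuccess κ E l₀ (.run m :: l) found =
      ∑ j, outcomeProb E m j * countSuccess κ E l₀ l (addSeed E found j) := by
  rw [countSuccess, QAlg.value_measure κ E (act_run l₀ m l found), ← sum_measureProb_mul]
  refine Finset.sum_congr rfl fun x _ => ?_
  rw [QAlg.value_test κ E (act_count_testing l₀ l found (outcome x))]
  congr 1
  exact QAlg.value_time_irrel _ κ E (fun k => if k = E.kSeed then 1 else 0) _ _ _

theorem countSuccess_check_of_lt {b : ℕ} (l : List CountInstr) {found : Finset (Triplet r)}
    (h : b < found.card) :
    countSuccess κ E l₀ (.check b :: l) found = countSuccess κ E l₀ l found :=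
  QAlg.value_congr_act κ E (act_check_of_lt l h) _ _

theorem countSuccess_check_of_le {b : ℕ} (l : List CountInstr) {found : Finset (Triplet r)}
    (h : found.card ≤ b) (hk : found.card = E.kSeed) :
    countSuccess κ E l₀ (.check b :: l) found = 1 :=
  (QAlg.value_halt κ E (act_check_of_le l h) _ _).trans (if_pos hk)

/-- One step of the coupon collector: a suitable Grover search decreases the expected number of
those among `F` good seeds that are yet to be found by the factor `1 - 1 / (2 F)`. -/
theorem sum_outcomeProb_missing_le {m F : ℕ} (hm : Suitable E m) (hF : F ≤ E.kSeed)
    {found : Finset (Triplet r)} (hf : found ⊆ E.goodSeeds) {x : ℝ} (hx : 0 ≤ x) :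
    ∑ j, outcomeProb E m j * ENNReal.ofReal ((F - (addSeed E found j).card : ℕ) * x) ≤
      ENNReal.ofReal ((F - found.card : ℕ) * ((1 - 1 / (2 * F)) * x)) := by
  rcases le_or_gt F found.card with h | h
  · have h0 : ∀ j, F - (addSeed E found j).card = 0 := fun j => by
      have := card_le_card_addSeed E found j
      omega
    simp [h0]
  have hsub : ((F - found.card : ℕ) : ℝ) = F - found.card := Nat.cast_sub h.le
  have h1 : (0 : ℝ) < F - found.card := by rw [← hsub]; exact_mod_cast Nat.sub_pos_of_lt h
  have hF0 : (0 : ℝ) < F := by linarith [(Nat.cast_nonneg found.card : (0 : ℝ) ≤ _)]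
  have hF1 : (1 : ℝ) ≤ F := by
    have : 1 ≤ F := by exact_mod_cast hF0
    exact_mod_cast this
  have hFk : (F : ℝ) ≤ E.kSeed := by exact_mod_cast hF
  have hq : 1 / (2 * (F : ℝ)) ≤ 1 := by
    rw [div_le_one (by positivity)]; linarith
  have hadd : ENNReal.ofReal ((F - found.card : ℕ) * x) =
      ENNReal.ofReal ((F - (found.card + 1) : ℕ) * x) + ENNReal.ofReal x := by
    rw [← ENNReal.ofReal_add (by positivity) hx]
    congr 1
    rw [hsub, Nat.cast_sub h]
    push_cast
    ring
  have hdrop := sum_outcomeProb_step_le E hm hf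
    (fun S => ENNReal.ofReal ((F - S.card : ℕ) * x)) _ _ hadd.le (fun j hj => by
      rw [Finset.card_insert_of_notMem (Finset.mem_sdiff.1 hj).2])
  rw [← hadd, ← ENNReal.ofReal_mul' hx] at hdrop
  have hsplit : ENNReal.ofReal ((F - found.card : ℕ) * x) =
      ENNReal.ofReal ((F - found.card : ℕ) * ((1 - 1 / (2 * F)) * x)) +
        ENNReal.ofReal ((F - found.card) / (2 * F) * x) := by
    rw [← ENNReal.ofReal_add]
    · congr 1
      rw [hsub]
      field_simp
      ring
    · exact mul_nonneg (Nat.cast_nonneg _) (mul_nonneg (by linarith) hx)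
    · exact mul_nonneg (div_nonneg h1.le (by positivity)) hx
  -- Since `F ≤ k`, the fraction still missing among `F` is at most the fraction still missing among
  -- all `k` seeds.
  have hle : ENNReal.ofReal ((F - found.card) / (2 * F) * x) ≤
      ENNReal.ofReal ((E.kSeed - found.card) / (2 * E.kSeed) * x) := by
    refine ENNReal.ofReal_le_ofReal (mul_le_mul_of_nonneg_right ?_ hx)
    rw [div_le_div_iff₀ (by positivity) (by linarith)]
    nlinarith [(Nat.cast_nonneg found.card : (0 : ℝ) ≤ _)]
  refine (ENNReal.add_le_add_iff_right (ENNReal.ofReal_ne_top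
    (r := (F - found.card) / (2 * F) * x))).1 ?_
  rw [← hsplit]
  exact le_trans (by gcongr) hdrop

open Classical in
/-- The coupon collector for a list of Grover searches. -/
theorem one_le_countSuccess_runs {F : ℕ} (hF : F ≤ E.kSeed) (l : List CountInstr) (δ : ℝ≥0∞)
    (hl : ∀ found ⊆ E.goodSeeds, F ≤ found.card → 1 ≤ countSuccess κ E l₀ l found + δ)
    (ms : List ℕ) {found : Finset (Triplet r)} (hf : found ⊆ E.goodSeeds) :
    1 ≤ countSuccess κ E l₀ (ms.map .run ++ l) found + δ +
      ENNReal.ofReal ((F - found.card : ℕ) *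
        (1 - 1 / (2 * F)) ^ ms.countP fun m => decide (Suitable E m)) := by
  have hρ : (0 : ℝ) ≤ 1 - 1 / (2 * F) := by
    rcases Nat.eq_zero_or_pos F with h | h
    · simp [h]
    · have : (1 : ℝ) ≤ F := by exact_mod_cast h
      rw [sub_nonneg, div_le_one (by positivity)]
      linarith
  induction ms generalizing found with
  | nil =>
    rcases le_or_gt F found.card with h | h
    · exact (hl found hf h).trans le_self_add
    -- With no searches left and fewer than `F` seeds found, the error term is at least `1`: the
    -- expected number of missing seeds bounds the probability that any is missing.
    · refine le_trans ?_ le_add_self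
      rw [List.countP_nil, pow_zero, mul_one, ENNReal.ofReal_natCast]
      exact_mod_cast Nat.sub_pos_of_lt h
  | cons m ms ih =>
    set c := ms.countP fun m => decide (Suitable E m) with hc
    have hx : (0 : ℝ) ≤ (1 - 1 / (2 * F)) ^ c := pow_nonneg hρ c
    have hstep : ∑ j, outcomeProb E m j * ENNReal.ofReal
        ((F - (addSeed E found j).card : ℕ) * (1 - 1 / (2 * F)) ^ c) ≤
        ENNReal.ofReal ((F - found.card : ℕ) *
          (1 - 1 / (2 * F)) ^ (m :: ms).countP fun m => decide (Suitable E m)) := by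
      by_cases hm : Suitable E m
      · rw [List.countP_cons_of_pos (by simpa using hm), pow_succ']
        exact sum_outcomeProb_missing_le E hm hF hf hx
      · rw [List.countP_cons_of_neg (by simpa using hm), ← hc]
        calc _ ≤ ∑ j, outcomeProb E m j * ENNReal.ofReal
              ((F - found.card : ℕ) * (1 - 1 / (2 * F)) ^ c) := by
              refine Finset.sum_le_sum fun j _ => mul_le_mul' le_rfl <|
                ENNReal.ofReal_le_ofReal <| mul_le_mul_of_nonneg_right ?_ hx
              exact_mod_cast Nat.sub_le_sub_left (card_le_card_addSeed E found j) F
          _ = _ := by rw [← Finset.sum_mul, sum_outcomeProb, one_mul]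
    rw [List.map_cons, List.cons_append, countSuccess_run]
    calc (1 : ℝ≥0∞) = ∑ j, outcomeProb E m j * 1 := by simp [sum_outcomeProb]
      _ ≤ ∑ j, outcomeProb E m j *
          (countSuccess κ E l₀ (ms.map .run ++ l) (addSeed E found j) + δ +
            ENNReal.ofReal ((F - (addSeed E found j).card : ℕ) * (1 - 1 / (2 * F)) ^ c)) := by
          gcongr with j
          exact ih (addSeed_subset E hf j)
      _ = _ := by
          simp only [mul_add, Finset.sum_add_distrib]
          rw [← Finset.sum_mul, sum_outcomeProb, one_mul]
      _ ≤ _ := by gcongr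

/-- Some number of iterations `(3 ^ j - 1) / 2` is suitable. -/
theorem exists_suitable {g : ℕ} (hg : g ≤ 3 * r) (hk : 2 ^ g < 2 * E.kSeed) :
    ∃ j ≤ Nat.log 9 (16 * 2 ^ (3 * r - g)), Suitable E ((3 ^ j - 1) / 2) := by
  have hk0 : 0 < E.kSeed := by
    have := Nat.two_pow_pos g
    omega
  have hθ := groverAngle_pos hk0
  have hθ' := groverAngle_le E
  have hpi := Real.pi_pos
  have hex : ∃ j : ℕ, Real.pi / 4 ≤ 3 ^ j * groverAngle E := by
    obtain ⟨j, hj⟩ := pow_unbounded_of_one_lt (Real.pi / 4 / groverAngle E)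
      (by norm_num : (1 : ℝ) < 3)
    exact ⟨j, ((div_lt_iff₀ hθ).1 hj).le⟩
  classical
  -- By minimality the angle `3^j θ` is below `3π/4` if `j > 0`; if `j = 0` it is `θ ≤ π/2`.
  set j := Nat.find hex with hjdef
  have hj : Real.pi / 4 ≤ 3 ^ j * groverAngle E := Nat.find_spec hex
  have hodd : (2 * (((3 ^ j - 1) / 2 : ℕ) : ℝ) + 1) = 3 ^ j := by
    have h2 : 2 * ((3 ^ j - 1) / 2) + 1 = 3 ^ j := by
      obtain ⟨c, hc⟩ : Odd (3 ^ j) := Odd.pow (by decide)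
      rw [hc]
      omega
    exact_mod_cast h2
  refine ⟨j, ?_, ?_⟩
  · refine Nat.le_log_of_pow_le (by norm_num) ?_
    rcases Nat.eq_zero_or_pos j with h0 | h0
    · rw [h0, pow_zero]
      have := Nat.two_pow_pos (3 * r - g)
      omega
    have hlt : 3 ^ (j - 1) * groverAngle E < Real.pi / 4 :=
      not_le.1 (Nat.find_min hex (by omega))
    have h3 : 3 ^ j * groverAngle E < 3 * Real.pi / 4 := by
      have : (3 : ℝ) ^ j = 3 * 3 ^ (j - 1) := by
        rw [← pow_succ', Nat.sub_add_cancel h0]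
      rw [this]
      linarith
    -- Squaring `3^j √(k/N) ≤ 3π/4` bounds `9^j k/N` by `6`. With `2^g < 2k` this gives `9^j ≤ 12 ·
    -- 2^(3r-g)`, rounded up to `16`.
    have h4 : (9 : ℝ) ^ j * (E.kSeed / 2 ^ (3 * r)) ≤ 6 := by
      calc (9 : ℝ) ^ j * (E.kSeed / 2 ^ (3 * r)) =
            (3 ^ j * √((E.kSeed : ℝ) / 2 ^ (3 * r))) ^ 2 := by
            rw [mul_pow, Real.sq_sqrt (kSeed_div_nonneg E), pow_right_comm]
            norm_num
        _ ≤ (3 * Real.pi / 4) ^ 2 := by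
            gcongr
            refine le_trans ?_ h3.le
            gcongr
            exact sqrt_le_groverAngle E
        _ ≤ 6 := by nlinarith [Real.pi_lt_d2]
    have hN : (2 : ℝ) ^ (3 * r) = 2 ^ (3 * r - g) * 2 ^ g := by
      rw [← pow_add, Nat.sub_add_cancel hg]
    have hk' : (2 : ℝ) ^ g < 2 * E.kSeed := by exact_mod_cast hk
    have hk0' : (0 : ℝ) < E.kSeed := by exact_mod_cast hk0
    have h5 : (9 : ℝ) ^ j ≤ 16 * 2 ^ (3 * r - g) := by
      rw [← mul_div_assoc, div_le_iff₀ (by positivity), hN] at h4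
      have h6 : (6 : ℝ) * (2 ^ (3 * r - g) * 2 ^ g) ≤ 16 * 2 ^ (3 * r - g) * E.kSeed := by
        have : (0 : ℝ) < 2 ^ (3 * r - g) := by positivity
        nlinarith
      exact le_of_mul_le_mul_right (h4.trans h6) hk0'
    exact_mod_cast h5
  · rw [Suitable, hodd]
    refine half_le_sin_sq hj ?_
    rcases Nat.eq_zero_or_pos j with h0 | h0
    · rw [h0, pow_zero, one_mul]
      linarith
    · have hlt : 3 ^ (j - 1) * groverAngle E < Real.pi / 4 :=
        not_le.1 (Nat.find_min hex (by omega))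
      have : (3 : ℝ) ^ j = 3 * 3 ^ (j - 1) := by
        rw [← pow_succ', Nat.sub_add_cancel h0]
      rw [this]
      linarith

/-- Each block of `2F` factors is at most `exp (-1) ≤ 1/2`. -/
theorem one_sub_pow_le {F T L : ℕ} (hF : 0 < F) (h : 2 * F * L ≤ T) :
    (1 - 1 / (2 * F) : ℝ) ^ T ≤ (1 / 2) ^ L := by
  have hF1 : (1 : ℝ) ≤ F := by exact_mod_cast hF
  have h0 : (0 : ℝ) ≤ 1 - 1 / (2 * F) := by
    rw [sub_nonneg, div_le_one (by positivity)]
    linarith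
  have h1 : (1 - 1 / (2 * F) : ℝ) ≤ 1 := sub_le_self _ (by positivity)
  have hhalf : (1 - 1 / (2 * F) : ℝ) ^ (2 * F) ≤ 1 / 2 := by
    calc (1 - 1 / (2 * F) : ℝ) ^ (2 * F) ≤ Real.exp (-(1 / (2 * F))) ^ (2 * F) := by
          gcongr
          exact Real.one_sub_le_exp_neg _
      _ = Real.exp (-1) := by
          rw [← Real.exp_nat_mul]
          congr 1
          push_cast
          field_simp
      _ ≤ 1 / 2 := by
          rw [Real.exp_neg, ← one_div]
          exact one_div_le_one_div_of_le two_pos (by linarith [Real.exp_one_gt_d9])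
  calc (1 - 1 / (2 * F) : ℝ) ^ T ≤ (1 - 1 / (2 * F)) ^ (2 * F * L) :=
        pow_le_pow_of_le_one h0 h1 h
    _ = ((1 - 1 / (2 * F)) ^ (2 * F)) ^ L := pow_mul _ _ _
    _ ≤ _ := by gcongr

open Classical in
theorem le_countP_phaseRuns {g : ℕ} (hg : g ≤ 3 * r) (hk : 2 ^ g < 2 * E.kSeed) :
    16 * r * (2 ^ g + 1) ≤ (phaseRuns r g).countP fun m => decide (Suitable E m) := by
  obtain ⟨j, hj, hs⟩ := exists_suitable E hg hk
  obtain ⟨a, b, hab⟩ := List.append_of_mem (List.mem_range.2 (Nat.lt_succ_of_le hj))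
  rw [phaseRuns, hab, List.flatMap_append, List.flatMap_cons, List.countP_append,
    List.countP_append, List.countP_replicate, if_pos (by simpa using hs)]
  omega

/-- Each phase fails with probability at most `2 ^ (-5 r)`. -/
theorem one_le_countSuccess_phases (n : ℕ) : ∀ g : ℕ, g + n = 3 * r + 1 →
    (E.kSeed = 0 ∨ 2 ^ g < 2 * E.kSeed) → ∀ found ⊆ E.goodSeeds,
    1 ≤ countSuccess κ E l₀ (phases r g n) found + ENNReal.ofReal (n * (1 / 2) ^ (5 * r)) := by
  classical
  induction n with
  | zero =>
    intro g hg hk found hf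
    have hcard : found.card ≤ E.kSeed := Finset.card_le_card hf
    -- After the last phase `g = 3r + 1`, and `2^g < 2k` would contradict `k ≤ 2^(3r)`.
    have h0 : E.kSeed = 0 := hk.resolve_right fun h => by
      have h1 := kSeed_le E
      have h2 : g = 3 * r + 1 := by omega
      rw [h2, pow_succ] at h
      omega
    have h1 : countSuccess κ E l₀ [] found = 1 :=
      (QAlg.value_halt κ E (a := found.card) rfl _ _).trans (if_pos (by omega))
    rw [phases, h1]
    exact le_self_add
  | succ n ih =>
    intro g hg hk found hf
    -- With `F` seeds found, either more than `2^g` are known and the check passes on to the next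
    -- phase, or all are known and the check returns `k`.
    obtain ⟨F, hF⟩ : ∃ F, F = min E.kSeed (2 ^ g + 1) := ⟨_, rfl⟩
    have hrest : ∀ S ⊆ E.goodSeeds, F ≤ S.card → 1 ≤ countSuccess κ E l₀
        (.check (2 ^ g) :: phases r (g + 1) n) S + ENNReal.ofReal (n * (1 / 2) ^ (5 * r)) := by
      intro S hS hFS
      have hcard : S.card ≤ E.kSeed := Finset.card_le_card hS
      rcases le_or_gt S.card (2 ^ g) with h | h
      · rw [countSuccess_check_of_le κ E l₀ _ h (by omega)]
        exact le_self_add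
      · rw [countSuccess_check_of_lt κ E l₀ _ h]
        exact ih (g + 1) (by omega) (Or.inr (by rw [pow_succ]; omega)) S hS
    have h := one_le_countSuccess_runs κ E l₀ (hF.trans_le (min_le_left _ _)) _ _ hrest (phaseRuns r g) hf
    refine h.trans ?_
    rw [phases, add_assoc]
    gcongr
    rw [← ENNReal.ofReal_add (by positivity)]
    · refine ENNReal.ofReal_le_ofReal ?_
      have hfail : ((F - found.card : ℕ) : ℝ) * (1 - 1 / (2 * F)) ^
          ((phaseRuns r g).countP fun m => decide (Suitable E m)) ≤ (1 / 2) ^ (5 * r) := by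
        rcases Nat.eq_zero_or_pos F with h0 | h0
        · rw [h0, Nat.zero_sub, Nat.cast_zero, zero_mul]
          positivity
        have hk' : 2 ^ g < 2 * E.kSeed := hk.resolve_left fun h => by omega
        have hcount := le_countP_phaseRuns E (by omega) hk'
        have hF2 : F ≤ 2 ^ g + 1 := hF.trans_le (min_le_right _ _)
        -- The `16 r (2^g + 1)` repetitions halve the expected number of missing seeds `8r` times,
        -- from at most `2^(3r)` to at most `2^(-5r)`.
        have hT : 2 * F * (8 * r) ≤ (phaseRuns r g).countP fun m => decide (Suitable E m) :=
          le_trans (by nlinarith) hcount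
        have hFN : ((F - found.card : ℕ) : ℝ) ≤ 2 ^ (3 * r) := by
          have : F - found.card ≤ 2 ^ (3 * r) :=
            (Nat.sub_le _ _).trans ((hF.trans_le (min_le_left _ _)).trans (kSeed_le E))
          exact_mod_cast this
        calc _ ≤ (2 : ℝ) ^ (3 * r) * (1 / 2) ^ (8 * r) :=
              mul_le_mul hFN (one_sub_pow_le h0 hT)
                (pow_nonneg (by
                  have : (1 : ℝ) ≤ F := by exact_mod_cast h0
                  rw [sub_nonneg, div_le_one (by positivity)]
                  linarith) _) (by positivity)
          _ = (1 / 2) ^ (5 * r) := by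
              rw [show 8 * r = 3 * r + 5 * r by ring, pow_add, ← mul_assoc, ← mul_pow]
              norm_num
      push_cast
      linarith
    · refine mul_nonneg (Nat.cast_nonneg _) (pow_nonneg ?_ _)
      rcases Nat.eq_zero_or_pos F with h0 | h0
      · simp [h0]
      · have : (1 : ℝ) ≤ F := by exact_mod_cast h0
        rw [sub_nonneg, div_le_one (by positivity)]
        linarith

/-- Union bound over the `3r + 1` phases: `(3r + 1) 2^(-5r) ≤ 1/4`. -/
theorem prob_seedCount_ge (hr : 1 ≤ r) :
    3 / 4 ≤ (seedCount r w).prob κ E fun k _ => k = E.kSeed := by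
  have h := one_le_countSuccess_phases κ E (phases r 0 (3 * r + 1)) (3 * r + 1) 0 (by omega)
    (by omega) ∅ (Finset.empty_subset _)
  have hsmall : ((3 * r + 1 : ℕ) : ℝ) * (1 / 2) ^ (5 * r) ≤ 1 / 4 := by
    have h1 : 4 * (3 * r + 1) ≤ 2 ^ (5 * r) := by
      have h2 : 5 * r < 2 ^ (5 * r) := Nat.lt_two_pow_self
      have h3 : 3 * r < 2 ^ (3 * r) := Nat.lt_two_pow_self
      have h4 : 4 ≤ 2 ^ (2 * r) := by
        calc 4 = 2 ^ 2 := by norm_num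
          _ ≤ 2 ^ (2 * r) := Nat.pow_le_pow_right (by norm_num) (by omega)
      calc 4 * (3 * r + 1) ≤ 2 ^ (2 * r) * 2 ^ (3 * r) := Nat.mul_le_mul h4 h3
        _ = 2 ^ (5 * r) := by rw [← pow_add]; congr 1; ring
    have h1' : (4 : ℝ) * ((3 * r + 1 : ℕ) : ℝ) ≤ 2 ^ (5 * r) := by exact_mod_cast h1
    rw [one_div, inv_pow, ← div_eq_mul_inv, div_le_div_iff₀ (by positivity) (by norm_num)]
    linarith
  have h34 : (3 / 4 : ℝ≥0∞) = ENNReal.ofReal (3 / 4) := by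
    rw [ENNReal.ofReal_div_of_pos (by norm_num)]
    simp
  rw [h34]
  refine ((ENNReal.add_le_add_iff_right (ENNReal.ofReal_ne_top (r := 1 / 4))).1 ?_).trans
    (QAlg.prob_eq_value (seedCount r w) κ E _).ge
  rw [← ENNReal.ofReal_add (by norm_num) (by norm_num)]
  norm_num only [ENNReal.ofReal_one]
  refine h.trans ?_
  gcongr
  exact le_rfl

/-! #### Running time of the counting algorithm -/

theorem expectedTimeFrom_congr_act {α : Type} {A : QAlg r w α} {s s' : A.S}
    (h : A.act s = A.act s') (N : ℕ) :
    A.expectedTimeFrom κ E (N + 1) s = A.expectedTimeFrom κ E (N + 1) s' := by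
  simp only [QAlg.expectedTimeFrom, h]

theorem expectedTimeFrom_runs_le (hr : 1 ≤ r) (l : List CountInstr) (B : ℝ≥0∞)
    (hl : ∀ N, ∀ found ⊆ E.goodSeeds,
      (countingProgram r w l₀).expectedTimeFrom κ E N (.running l found) ≤ B) (ms : List ℕ) :
    ∀ N, ∀ found ⊆ E.goodSeeds,
      (countingProgram r w l₀).expectedTimeFrom κ E N (.running (ms.map .run ++ l) found) ≤
        ((ms.map fun m => κ.stepFactor * r * (m + 1)).sum : ℕ) + B := by
  induction ms with
  | nil => simpa using hl
  | cons m ms ih =>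
    intro N found hf
    set B' : ℝ≥0∞ := ((ms.map fun m => κ.stepFactor * r * (m + 1)).sum : ℕ) + B
    cases N with
    | zero => simp [QAlg.expectedTimeFrom]
    | succ N =>
      rw [List.map_cons, List.cons_append,
        QAlg.expectedTimeFrom_measure κ E (act_run l₀ m _ found)]
      have h : ∀ j, (countingProgram r w l₀).expectedTimeFrom κ E N
          (.testing (ms.map .run ++ l) found j) ≤ κ.test + B' := by
        intro j
        cases N with
        | zero => simp [QAlg.expectedTimeFrom]
        | succ N =>
          rw [QAlg.expectedTimeFrom_test κ E (act_count_testing l₀ _ found j)]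
          gcongr
          exact ih N (addSeed E found j) (addSeed_subset E hf j)
      calc _ ≤ (circuitCost κ (groverCircuit r w m) : ℝ≥0∞) +
            ∑ x, measureProb E (groverCircuit r w m) x * (κ.test + B') := by
            gcongr
            exact h _
        _ = ((circuitCost κ (groverCircuit r w m) + κ.test : ℕ) : ℝ≥0∞) + B' := by
            rw [← Finset.sum_mul, sum_measureProb, one_mul]
            push_cast
            ring
        _ ≤ ((κ.stepFactor * r * (m + 1) : ℕ) : ℝ≥0∞) + B' := by
            gcongr
            exact circuitCost_groverCircuit_le hr κ m
        _ = _ := by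
            simp only [B', List.map_cons, List.sum_cons]
            push_cast
            ring

/-- At most `8r` iteration numbers, each with `m + 1 ≤ 3^J` and `3^J ≤ 4 √(N / 2^g)`, are repeated
`16 r (2^g + 1) ≤ 32 r 2^g` times; `1024 = 8 · 32 · 4`. -/
theorem sum_phaseRuns_le (hr : 1 ≤ r) (K : ℕ) {g : ℕ} (hg : g ≤ 3 * r) :
    (((phaseRuns r g).map fun m => K * r * (m + 1)).sum : ℝ) ≤
      1024 * K * r ^ 3 * √(2 ^ (3 * r) * 2 ^ g) := by
  set J := Nat.log 9 (16 * 2 ^ (3 * r - g))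
  have hsum : ((phaseRuns r g).map fun m => K * r * (m + 1)).sum ≤
      (J + 1) * (16 * r * (2 ^ g + 1) * (K * r * 3 ^ J)) := by
    have h1 : ∀ n, n ≤ J + 1 → (((List.range n).flatMap fun j =>
        List.replicate (16 * r * (2 ^ g + 1)) ((3 ^ j - 1) / 2)).map
          fun m => K * r * (m + 1)).sum ≤ n * (16 * r * (2 ^ g + 1) * (K * r * 3 ^ J)) := by
      intro n
      induction n with
      | zero => simp
      | succ n ih =>
        intro hn
        rw [List.range_succ, List.flatMap_append, List.map_append, List.sum_append]
        have h2 : (3 ^ n - 1) / 2 + 1 ≤ 3 ^ J := by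
          have h3 : 3 ^ n ≤ 3 ^ J := Nat.pow_le_pow_right (by norm_num) (by omega)
          have h4 : 0 < 3 ^ n := by positivity
          omega
        have h5 : ((([n] : List ℕ).flatMap fun j =>
            List.replicate (16 * r * (2 ^ g + 1)) ((3 ^ j - 1) / 2)).map
              fun m => K * r * (m + 1)).sum ≤ 16 * r * (2 ^ g + 1) * (K * r * 3 ^ J) := by
          simp only [List.flatMap_cons, List.flatMap_nil, List.append_nil, List.map_replicate,
            List.sum_replicate, smul_eq_mul]
          gcongr
        have := ih (by omega)
        linarith
    exact h1 (J + 1) le_rfl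
  have hJ : J + 1 ≤ 8 * r := by
    have h1 : J ≤ 3 * r + 4 := by
      calc J ≤ Nat.log 2 (16 * 2 ^ (3 * r - g)) := Nat.log_anti_left (by norm_num) (by norm_num)
        _ ≤ Nat.log 2 (2 ^ (3 * r + 4)) := by
            refine Nat.log_mono_right ?_
            rw [pow_add, mul_comm]
            exact Nat.mul_le_mul (Nat.pow_le_pow_right (by norm_num) (by omega)) (by norm_num)
        _ = 3 * r + 4 := Nat.log_pow (by norm_num) _
    omega
  have h3J : ((3 : ℝ) ^ J) ≤ 4 * √(2 ^ (3 * r) / 2 ^ g) := by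
    have h1 : 9 ^ J ≤ 16 * 2 ^ (3 * r - g) :=
      Nat.pow_log_le_self 9 (by positivity)
    have h1' : (9 : ℝ) ^ J ≤ 16 * 2 ^ (3 * r - g) := by exact_mod_cast h1
    have h2 : (2 : ℝ) ^ (3 * r - g) = 2 ^ (3 * r) / 2 ^ g := by
      rw [eq_div_iff (by positivity), ← pow_add, Nat.sub_add_cancel hg]
    have h3 : ((3 : ℝ) ^ J) ^ 2 ≤ (4 * √(2 ^ (3 * r) / 2 ^ g)) ^ 2 := by
      rw [mul_pow, Real.sq_sqrt (by positivity), ← h2, ← pow_mul, mul_comm J 2, pow_mul]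
      norm_num
      exact h1'
    exact le_of_sq_le_sq h3 (by positivity)
  have hg1 : (1 : ℝ) ≤ 2 ^ g := one_le_pow₀ (by norm_num)
  have hJ' : (J : ℝ) + 1 ≤ 8 * r := by exact_mod_cast hJ
  have hs : √((2 : ℝ) ^ (3 * r) * 2 ^ g) = √(2 ^ (3 * r) / 2 ^ g) * 2 ^ g := by
    have h0 : (0 : ℝ) ≤ 2 ^ g := by positivity
    rw [← Real.sqrt_sq h0, ← Real.sqrt_mul (by positivity), Real.sqrt_sq h0]
    congr 1
    field_simp
  calc (((phaseRuns r g).map fun m => K * r * (m + 1)).sum : ℝ)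
      ≤ ((J : ℝ) + 1) * (16 * r * (2 ^ g + 1) * (K * r * 3 ^ J)) := by exact_mod_cast hsum
    _ ≤ (8 * r) * (16 * r * (2 ^ g + 2 ^ g) * (K * r * (4 * √(2 ^ (3 * r) / 2 ^ g)))) := by
        gcongr
    _ = _ := by rw [hs]; ring

/-- A phase `g > 0` is entered only with more than `2^(g-1)` good seeds in hand. So `2^g ≤ 2 max(k,
1)` holds in every phase that is run, with certainty, and all phases obey one common bound. -/
theorem expectedTimeFrom_phases_le (hr : 1 ≤ r) (n : ℕ) : ∀ g : ℕ, g + n ≤ 3 * r + 1 →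
    (g = 0 ∨ 2 ^ g < 2 * E.kSeed) → ∀ N, ∀ found ⊆ E.goodSeeds,
    (countingProgram r w l₀).expectedTimeFrom κ E N (.running (phases r g n) found) ≤
      n * ENNReal.ofReal (2048 * κ.stepFactor * r ^ 3 * √(2 ^ (3 * r) * (max E.kSeed 1 : ℕ))) := by
  set P := ENNReal.ofReal
    (2048 * κ.stepFactor * r ^ 3 * √(2 ^ (3 * r) * (max E.kSeed 1 : ℕ)))
  induction n with
  | zero =>
    intro g _ _ N found _
    cases N with
    | zero => simp [QAlg.expectedTimeFrom]
    | succ N =>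
      exact (QAlg.expectedTimeFrom_halt (A := countingProgram r w l₀) (s := .running [] found) κ E
        (a := found.card) rfl N).le.trans zero_le
  | succ n ih =>
    intro g hg hk N found hf
    have hrest : ∀ N, ∀ S ⊆ E.goodSeeds, (countingProgram r w l₀).expectedTimeFrom κ E N
        (.running (.check (2 ^ g) :: phases r (g + 1) n) S) ≤ n * P := by
      intro N S hS
      cases N with
      | zero => simp [QAlg.expectedTimeFrom]
      | succ N =>
        rcases le_or_gt S.card (2 ^ g) with h | h
        · rw [QAlg.expectedTimeFrom_halt κ E (act_check_of_le _ h)]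
          exact zero_le
        · have hcard : S.card ≤ E.kSeed := Finset.card_le_card hS
          rw [expectedTimeFrom_congr_act κ E (act_check_of_lt _ h)]
          exact ih (g + 1) (by omega) (Or.inr (by rw [pow_succ]; omega)) _ S hS
    refine (expectedTimeFrom_runs_le κ E l₀ hr _ _ hrest (phaseRuns r g) N found hf).trans ?_
    have hP : (((phaseRuns r g).map fun m => κ.stepFactor * r * (m + 1)).sum : ℝ≥0∞) ≤ P := by
      rw [← ENNReal.ofReal_natCast]
      refine ENNReal.ofReal_le_ofReal ((sum_phaseRuns_le hr _ (by omega)).trans ?_)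
      have hg2 : 2 ^ g ≤ 2 * max E.kSeed 1 := by
        rcases hk with rfl | h
        · simp; omega
        · omega
      have hg2' : (2 : ℝ) ^ g ≤ 2 * (max E.kSeed 1 : ℕ) := by exact_mod_cast hg2
      have hsq : √((2 : ℝ) ^ (3 * r) * 2 ^ g) ≤ 2 * √(2 ^ (3 * r) * (max E.kSeed 1 : ℕ)) := by
        refine Real.sqrt_le_iff.2 ⟨by positivity, ?_⟩
        rw [mul_pow, Real.sq_sqrt (by positivity)]
        have h0 : (0 : ℝ) ≤ 2 ^ (3 * r) * (max E.kSeed 1 : ℕ) := by positivity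
        calc (2 : ℝ) ^ (3 * r) * 2 ^ g ≤ 2 ^ (3 * r) * (2 * (max E.kSeed 1 : ℕ)) := by gcongr
          _ ≤ _ := by linarith
      calc (1024 * κ.stepFactor * r ^ 3 * √((2 : ℝ) ^ (3 * r) * 2 ^ g))
          ≤ 1024 * κ.stepFactor * r ^ 3 * (2 * √(2 ^ (3 * r) * (max E.kSeed 1 : ℕ))) := by gcongr
        _ = _ := by ring
    calc _ ≤ P + n * P := by gcongr
      _ = _ := by push_cast; ring

theorem expectedTime_seedCount_le (hr : 1 ≤ r) :
    (seedCount r w).expectedTime κ E ≤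
      ENNReal.ofReal (8192 * κ.stepFactor * r ^ 4 * √(2 ^ (3 * r) * (max E.kSeed 1 : ℕ))) := by
  refine iSup_le fun N => ?_
  refine (expectedTimeFrom_phases_le κ E (phases r 0 (3 * r + 1)) hr (3 * r + 1) 0 (by omega)
    (Or.inl rfl) N ∅ (Finset.empty_subset _)).trans ?_
  rw [← ENNReal.ofReal_natCast, ← ENNReal.ofReal_mul (by positivity)]
  refine ENNReal.ofReal_le_ofReal ?_
  have hr' : ((3 * r + 1 : ℕ) : ℝ) ≤ 4 * r := by
    have : 3 * r + 1 ≤ 4 * r := by omega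
    exact_mod_cast this
  calc _ ≤ (4 * r) * (2048 * κ.stepFactor * r ^ 3 *
        √((2 : ℝ) ^ (3 * r) * (max E.kSeed 1 : ℕ))) := by gcongr
    _ = _ := by ring

end Counting

/-! ### The main theorem -/

theorem timeBound_eq (D : ℝ) (p r k : ℕ) :
    timeBound (D / Real.log 2 ^ p) p r k =
      D * r ^ p * √(2 ^ (3 * r) * (max k 1 : ℕ)) := by
  have hlog : (0 : ℝ) < Real.log 2 := Real.log_pos (by norm_num)
  rw [timeBound, Real.log_pow, mul_pow, ← pow_mul, mul_comm r 3]
  field_simp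

/-- Raising the exponent of the logarithm lets two bounds with different exponents be added. `C` may
be negative, hence the absolute value. -/
theorem timeBound_le_timeBound_add {r : ℕ} (hr : 1 ≤ r) (C : ℝ) (p q k : ℕ) :
    timeBound C p r k ≤ timeBound (|C| / Real.log 2 ^ q) (p + q) r k := by
  have hlog : (0 : ℝ) < Real.log 2 := Real.log_pos (by norm_num)
  have h1 : 1 ≤ (r : ℝ) ^ q := one_le_pow₀ (by exact_mod_cast hr)
  have hL : Real.log ((2 : ℝ) ^ r) = r * Real.log 2 := Real.log_pow _ _
  have h : |C| / Real.log 2 ^ q * √(((2 : ℝ) ^ r) ^ 3 * (max k 1 : ℕ)) *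
      (r * Real.log 2) ^ (p + q) =
      |C| * √(((2 : ℝ) ^ r) ^ 3 * (max k 1 : ℕ)) * (r * Real.log 2) ^ p * r ^ q := by
    rw [pow_add, mul_pow _ _ q]
    field_simp
  rw [timeBound, timeBound, hL, h]
  have h0 : 0 ≤ |C| * √(((2 : ℝ) ^ r) ^ 3 * (max k 1 : ℕ)) * (r * Real.log 2) ^ p := by positivity
  calc C * √(((2 : ℝ) ^ r) ^ 3 * (max k 1 : ℕ)) * (r * Real.log 2) ^ p
      ≤ |C| * √(((2 : ℝ) ^ r) ^ 3 * (max k 1 : ℕ)) * (r * Real.log 2) ^ p := by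
        gcongr
        exact le_abs_self C
    _ ≤ _ := le_mul_of_one_le_right h0 h1

theorem timeBound_linear (a b C D : ℝ) (p r k : ℕ) :
    timeBound (a * C + b * D) p r k = a * timeBound C p r k + b * timeBound D p r k := by
  simp only [timeBound]
  ring

theorem timeBound_pos {r : ℕ} (hr : 1 ≤ r) {C : ℝ} (hC : 0 < C) (p k : ℕ) :
    0 < timeBound C p r k := by
  have hlog : (0 : ℝ) < Real.log (2 ^ r) :=
    Real.log_pos (one_lt_pow₀ (by norm_num) (by omega))
  have hk : (0 : ℝ) < (max k 1 : ℕ) := by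
    have : 0 < max k 1 := by omega
    exact_mod_cast this
  rw [timeBound]
  positivity

theorem isQuantumCounting_seedCount (κ : CostModel) : IsQuantumCounting κ seedCount := by
  refine ⟨8192 * κ.stepFactor / Real.log 2 ^ 4, 4, fun r w hr E => ?_⟩
  rw [timeBound_eq]
  exact ⟨prob_seedCount_ge κ E hr, expectedTime_seedCount_le κ E hr⟩

/-- Markov's inequality for the running time. -/
theorem QAlg.prob_le_prob_time_le_add {r w : ℕ} {α : Type} (A : QAlg r w α) (κ : CostModel)
    (E : Event r w) (P : α → Prop) {B : ℝ} (hB : 0 < B) :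
    A.prob κ E (fun a _ => P a) ≤
      A.prob κ E (fun a t => P a ∧ (t : ℝ) ≤ B) + A.timeOn κ E P / ENNReal.ofReal B := by
  classical
  rw [QAlg.prob_eq_value, QAlg.prob_eq_value, QAlg.timeOn_eq_value, ENNReal.div_eq_inv_mul,
    ← QAlg.value_const_mul]
  refine (A.value_mono κ E (fun a t => ?_) _ _).trans (A.value_add_le κ E _ _ _ _)
  by_cases hP : P a
  · by_cases ht : (t : ℝ) ≤ B
    · simp [hP, ht]
    · simp only [hP, ht, and_false, if_true, if_false, zero_add]
      rw [← ENNReal.div_eq_inv_mul, ENNReal.le_div_iff_mul_le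
        (Or.inl (ENNReal.ofReal_pos.2 hB).ne') (Or.inl ENNReal.ofReal_ne_top), one_mul,
        ← ENNReal.ofReal_natCast]
      exact ENNReal.ofReal_le_ofReal (not_le.1 ht).le
  · simp [hP]

/-- Quantum seed generation with a subroutine that is correct with probability at least `3/4`. -/
theorem quantumSeeding_bounds (κ : CostModel) {r w : ℕ} (hr : 1 ≤ r) (count : QAlg r w ℕ)
    (E : Event r w) {T R : ℝ} (hT : 0 ≤ T) (hR : 0 < R)
    (hprob : 3 / 4 ≤ count.prob κ E fun k _ => k = E.kSeed)
    (htime : count.expectedTime κ E ≤ ENNReal.ofReal T)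
    (hsearch : 16 * κ.stepFactor * r ^ 2 * √(2 ^ (3 * r) * E.kSeed) ≤ R) :
    1 / 2 ≤ (quantumSeeding count).prob κ E
      (fun seeds t => seeds = E.goodSeeds ∧ (t : ℝ) ≤ 8 * T + 4 * R) ∧
    (quantumSeeding count).timeOn κ E (fun seeds => seeds = E.goodSeeds) /
        (quantumSeeding count).prob κ E (fun seeds _ => seeds = E.goodSeeds) ≤
      ENNReal.ofReal (8 * T + 4 * R) := by
  have hpe := prob_quantumSeeding count κ E
  set p := count.prob κ E fun k _ => k = E.kSeed with hp
  have hp1 : p ≤ 1 := by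
    rw [hp, QAlg.prob_eq_value]
    exact QAlg.value_le_one κ E count (fun a _ => by split_ifs <;> simp) _ _
  -- Since `p ≥ 3/4 ≥ 1/2`, a factor `p` can be inserted at the price of doubling `T`; it then
  -- cancels in the conditional expectation.
  have hTp : ENNReal.ofReal T ≤ ENNReal.ofReal (2 * T) * p := by
    calc ENNReal.ofReal T ≤ ENNReal.ofReal (2 * T * (3 / 4)) :=
          ENNReal.ofReal_le_ofReal (by linarith)
      _ = ENNReal.ofReal (2 * T) * (3 / 4) := by
          rw [ENNReal.ofReal_mul (by linarith), ENNReal.ofReal_div_of_pos (by norm_num)]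
          simp
      _ ≤ _ := by gcongr
  have hbound : (quantumSeeding count).timeOn κ E (fun seeds => seeds = E.goodSeeds) ≤
      ENNReal.ofReal (2 * T + R) * p := by
    refine (timeOn_quantumSeeding_le count κ E hr).trans ?_
    rw [ENNReal.ofReal_add (by linarith) hR.le, add_mul]
    gcongr
    exact htime.trans hTp
  constructor
  · have hmarkov := QAlg.prob_le_prob_time_le_add (quantumSeeding count) κ E
      (fun seeds => seeds = E.goodSeeds) (B := 8 * T + 4 * R) (by linarith)
    rw [hpe] at hmarkov
    -- The bound `8T + 4R` is four times the restricted expectation bound `2T + R`, so Markov loses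
    -- at most `1/4` of the success probability `3/4`.
    have hquarter : (quantumSeeding count).timeOn κ E (fun seeds => seeds = E.goodSeeds) /
        ENNReal.ofReal (8 * T + 4 * R) ≤ ENNReal.ofReal (1 / 4) := by
      refine ENNReal.div_le_of_le_mul ?_
      rw [← ENNReal.ofReal_mul (by norm_num)]
      refine (hbound.trans (mul_le_of_le_one_right zero_le hp1)).trans
        (ENNReal.ofReal_le_ofReal (by linarith))
    have h34 : (3 / 4 : ℝ≥0∞) = ENNReal.ofReal (3 / 4) := by
      rw [ENNReal.ofReal_div_of_pos (by norm_num)]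
      simp
    have h12 : (1 / 2 : ℝ≥0∞) = ENNReal.ofReal (1 / 2) := by
      rw [ENNReal.ofReal_div_of_pos (by norm_num)]
      simp
    refine (ENNReal.add_le_add_iff_right (ENNReal.ofReal_ne_top (r := 1 / 4))).1 ?_
    rw [h12, ← ENNReal.ofReal_add (by norm_num) (by norm_num),
      show (1 / 2 + 1 / 4 : ℝ) = 3 / 4 by norm_num, ← h34]
    exact hprob.trans (hmarkov.trans (by gcongr))
  · rw [hpe]
    refine ENNReal.div_le_of_le_mul (hbound.trans ?_)
    gcongr <;> linarith

end

end SeedGen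

theorem mainTheorem7 (κ : SeedGen.CostModel) :
    (∃ count : (r w : ℕ) → SeedGen.QAlg r w ℕ, SeedGen.IsQuantumCounting κ count) ∧
    ∀ count : (r w : ℕ) → SeedGen.QAlg r w ℕ, SeedGen.IsQuantumCounting κ count →
      ∃ (C : ℝ) (p : ℕ), ∀ (r w : ℕ), 1 ≤ r → ∀ E : SeedGen.Event r w,
        (SeedGen.quantumSeeding (count r w)).prob κ E
            (fun seeds _ => seeds = E.goodSeeds)
          = (count r w).prob κ E (fun k _ => k = E.kSeed) ∧
        1 / 2 ≤ (SeedGen.quantumSeeding (count r w)).prob κ E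
            (fun seeds t =>
              seeds = E.goodSeeds ∧ (t : ℝ) ≤ SeedGen.timeBound C p r E.kSeed) ∧
        (SeedGen.quantumSeeding (count r w)).timeOn κ E (fun seeds => seeds = E.goodSeeds)
            / (SeedGen.quantumSeeding (count r w)).prob κ E
                (fun seeds _ => seeds = E.goodSeeds)
          ≤ ENNReal.ofReal (SeedGen.timeBound C p r E.kSeed) := by
  refine ⟨⟨SeedGen.seedCount, SeedGen.isQuantumCounting_seedCount κ⟩, ?_⟩
  rintro count ⟨C, p, hcount⟩
  have hK : (0 : ℝ) < κ.stepFactor := by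
    rw [SeedGen.CostModel.stepFactor]
    positivity
  have hlog : (0 : ℝ) < Real.log 2 := Real.log_pos (by norm_num)
  -- `C₁` and `C₂` express the counting bound (exponent `p`) and the loop bound (exponent `2`,
  -- constant `16 · stepFactor`) with the common exponent `p + 2`.
  set C₁ : ℝ := |C| / Real.log 2 ^ 2
  set C₂ : ℝ := |16 * (κ.stepFactor : ℝ) / Real.log 2 ^ 2| / Real.log 2 ^ p
  have hC₂pos : 0 < C₂ := by positivity
  refine ⟨8 * C₁ + 4 * C₂, p + 2, fun r w hr E => ?_⟩
  obtain ⟨hprob, htime⟩ := hcount r w hr E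
  refine ⟨SeedGen.prob_quantumSeeding (count r w) κ E, ?_⟩
  rw [SeedGen.timeBound_linear]
  refine SeedGen.quantumSeeding_bounds κ hr (count r w) E ?_
    (SeedGen.timeBound_pos hr hC₂pos _ _) hprob
    (htime.trans (ENNReal.ofReal_le_ofReal (SeedGen.timeBound_le_timeBound_add hr C p 2 _))) ?_
  · have h1 : 0 ≤ Real.log ((2 : ℝ) ^ r) := Real.log_nonneg (one_le_pow₀ (by norm_num))
    rw [SeedGen.timeBound]
    positivity
  · rw [add_comm p 2]
    refine le_trans ?_ (SeedGen.timeBound_le_timeBound_add hr _ 2 p _)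
    rw [SeedGen.timeBound_eq]
    gcongr
    exact le_max_left _ _
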